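/- Let $m\ge 1$ and let $a\in C^{m+1}[0,1]$, $b\in C^m[0,1]$ be real-valued. Consider the eigenvalue problem $$u''-(\lambda^2+2\lambda a-b)u=0 \ \text{ on } (0,1),\qquad u(0)=u(1)=0, \tag{1}$$ where the algebraic multiplicity of an eigenvalue $\lambda$ is its order as a zero of the entire function $\lambda\mapsto u(1,\lambda)$, $u(\cdot,\lambda)$ being the solution of the equation with $u(0,\lambda)=0$, $u'(0,\lambda)=1$. Write $\langle f\rangle=\int_0^1 f(x)\,dx$. The eigenvalues of (1), repeated according to algebraic multiplicity, can be numbered as $\lambda_n$, $n\in\mathbb Z\setminus\{0\}$, so that $\operatorname{Im}\lambda_k\le\operatorname{Im}\lambda_n$ for $k\le n$ and $\lambda_{-n}=\overline{\lambda_n}$ whenever $\lambda_n\notin\mathbb R$. For every such numbering, $$\lambda_n=\pi n\mathrm i+\sum_{j=0}^{m-1}c_jn^{-j}+\mathcal O(n^{-m})\qquad\text{as } n\to+\infty \text{ and as } n\to-\infty .$$ Here the numbers $c_j$ are determined by $a$ and $b$ explicitly, as follows. Put $\phi_0^{(\pm)}=a$, $\phi_1^{(\pm)}=-\frac12(\pm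 a'+a^2+b)$ and $$\phi_i^{(\pm)}=-\frac12\Big(\pm\big(\phi_{i-1}^{(\pm)}\big)'+\sum_{k=0}^{i-1}\phi_k^{(\pm)}\phi_{i-1-k}^{(\pm)}\Big),\quad i\ge2,\qquad g_i=\tfrac12\big\langle\phi_i^{(+)}+\phi_i^{(-)}\big\rangle .$$ Let $w=N+\sum_{j\ge0}d_jN^{-j}$ be the formal series solution of $w+\sum_{i\ge0}g_iw^{-i}=N$; comparing coefficients determines $d_j$ recursively from $g_0,\dots,g_j$ and $d_0,\dots,d_{j-1}$. Then $c_j=d_j(\pi\mathrm i)^{-j}$. In particular, $$c_0=-\langle a\rangle,\qquad c_1=\frac{\langle a^2+b\rangle}{2\pi\mathrm i},\qquad c_2=\frac1{2\pi^2}\Big[\langle a(a^2+b)\rangle-\langle a\rangle\langle a^2+b\rangle+\frac{a'(1)-a'(0)}2\Big].$$ -/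

import Mathlib

open Set Filter Topology Asymptotics

noncomputable section

namespace DampedWave

/-- The mean value `⟨f⟩ = ∫₀¹ f(x) dx`. -/
def mean (f : ℝ → ℝ) : ℝ := ∫ x in (0 : ℝ)..1, f x

/-- The (one-sided at the end points) derivative of a function on `[0,1]`. -/
def D (f : ℝ → ℝ) : ℝ → ℝ := derivWithin f (Icc 0 1)

/-- `u` is a classical solution on `[0,1]`, with derivative `v`, of
`u'' - (z² + 2 z a - b) u = 0`. -/
def IsSolution (a b : ℝ → ℝ) (z : ℂ) (u v : ℝ → ℂ) : Prop :=
  ∀ x ∈ Icc (0 : ℝ) 1,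
    HasDerivWithinAt u (v x) (Icc 0 1) x ∧
    HasDerivWithinAt v ((z ^ 2 + 2 * z * (a x : ℂ) - (b x : ℂ)) * u x) (Icc 0 1) x

/-- `z` is an eigenvalue of `u'' - (z² + 2 z a - b) u = 0`, `u(0) = u(1) = 0`. -/
def IsEigenvalue (a b : ℝ → ℝ) (z : ℂ) : Prop :=
  ∃ u v : ℝ → ℂ, IsSolution a b z u v ∧ u 0 = 0 ∧ u 1 = 0 ∧ ∃ x ∈ Icc (0 : ℝ) 1, u x ≠ 0

/-- The characteristic function `z ↦ u(1, z)`, where `u(·, z)` is the solution of the equation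
with `u(0) = 0`, `u'(0) = 1` (which exists and is unique on `[0,1]` for continuous `a`, `b`). -/
def charFun (a b : ℝ → ℝ) (z : ℂ) : ℂ :=
  Classical.epsilon fun w : ℂ =>
    ∃ u v : ℝ → ℂ, IsSolution a b z u v ∧ u 0 = 0 ∧ v 0 = 1 ∧ u 1 = w

/-- The algebraic multiplicity of `z`: its order as a zero of the characteristic function. -/
def algMult (a b : ℝ → ℝ) (z : ℂ) : ℕ∞ := analyticOrderAt (charFun a b) z

/-- `ev n`, `n ∈ ℤ \ {0}`, is a numbering of all the eigenvalues, each repeated according to its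
algebraic multiplicity, by nondecreasing imaginary part and with `ev (-n)` conjugate to `ev n`
for the non-real ones. The value `ev 0` plays no role. -/
structure IsNumbering (a b : ℝ → ℝ) (ev : ℤ → ℂ) : Prop where
  isEigenvalue : ∀ n : ℤ, n ≠ 0 → IsEigenvalue a b (ev n)
  mult : ∀ z : ℂ, IsEigenvalue a b z → {n : ℤ | n ≠ 0 ∧ ev n = z}.encard = algMult a b z
  im_mono : ∀ k n : ℤ, k ≠ 0 → n ≠ 0 → k ≤ n → (ev k).im ≤ (ev n).im
  conj : ∀ n : ℤ, n ≠ 0 → (ev n).im ≠ 0 → ev (-n) = (starRingEnd ℂ) (ev n)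

/-- The coefficients `φ_i^{(±)}` (with `s = ±1`) of the formal solutions
`exp (± z x ± ∫₀ˣ ∑ φ_i^{(±)}(t) z^{-i} dt)` of the equation. -/
def phi (s : ℝ) (a b : ℝ → ℝ) : ℕ → ℝ → ℝ
  | 0 => a
  | 1 => fun x => -(1 / 2) * (s * D a x + a x ^ 2 + b x)
  | i + 2 => fun x => -(1 / 2) * (s * D (phi s a b (i + 1)) x +
      ∑ j : Fin (i + 2), phi s a b j x * phi s a b (i + 1 - j) x)
  termination_by i => i
  decreasing_by all_goals omega

/-- `g_i = ⟨φ_i^{(+)} + φ_i^{(-)}⟩ / 2`. -/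
def g (a b : ℝ → ℝ) (i : ℕ) : ℝ :=
  mean (fun x => phi 1 a b i x + phi (-1) a b i x) / 2

/-- The coefficients `d_j` of the formal solution `w = N + ∑_j d_j N^{-j}` of
`w + ∑_i q_i w^{-i} = N`. With `X = 1/N` and `w = N W`, `W = 1 + ∑_l d_l X^(l+1)`, one compares
coefficients in `∑_j d_j X^j = - ∑_i q_i X^i W^{-i}`; for `X^j` only `d_l` with `l < j` enter on
the right. -/
def revert (q : ℕ → ℝ) (j : ℕ) : ℝ :=
  -∑ i ∈ Finset.range (j + 1), q i * PowerSeries.coeff (j - i)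
    (((1 + ∑ l : Fin j, PowerSeries.C (revert q l) * PowerSeries.X ^ ((l : ℕ) + 1) :
      PowerSeries ℝ)⁻¹) ^ i)
  termination_by j
  decreasing_by exact l.isLt

/-- The coefficients `c_j`: `∑_j c_j n^{-j} = ∑_j d_j (π n i)^{-j}`, where
`w = π n i + ∑_j d_j (π n i)^{-j}` solves `w + ∑_i g_i w^{-i} = π n i` formally. -/
def c (a b : ℝ → ℝ) (j : ℕ) : ℂ :=
  (revert (g a b) j : ℂ) / ((Real.pi : ℂ) * Complex.I) ^ j

end DampedWave

end

namespace DampedWave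

/-! ### The Volterra operator and the initial value problem -/

/-! For large `|z|` the equation has approximate solutions `exp (±(z x + ∫₀ˣ P))` with `P = ∑_{i<m}
φ_i z^{-i}`. Their logarithmic derivatives should satisfy the Riccati equation `±P' + (z + P)² = z²
+ 2 z a - b`. The recursion for `φ_i` solves it order by order in `1/z` and leaves a residual of
size `|z|^{1-m}` (`riccati_wkb`). Written in the two approximate modes, the first-order system for
`(u, u')` is diagonal up to a perturbation of size `|z|^{-m}`, since passing back to `u` divides by
about `2z`. Hence a nonvanishing multiple of `u(1, z)` equals `exp Φ - 1` up to `O(|z|^{-m}) max(1,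
|exp Φ|)`, where `Φ = 2 (z + ∑_{i<m} g_i z^{-i})` (`charFun_asymptotics`). Every large eigenvalue
therefore satisfies `z + ∑ g_i z^{-i} = π k i + O(|z|^{-m})` for some integer `k`
(`exists_int_phase_close`), and reversion of the series gives its expansion in powers of `1/k`
(`sub_revert_isBigO`).

It remains to see that `k` is the index `n`. Rouché's theorem on discs of radius `π (n + 1/2)` about
`-⟨a⟩`, with comparison function `exp (2 (z + ⟨a⟩)) - 1`, shows that such a disc holds exactly `2n`
eigenvalues: the comparison function has `2n + 1` zeros, one of which is accounted for by the
prefactor `2z + 2a(1)`. For large `n` the disc contains the same eigenvalues as the strip `|Im z| <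
π (n + 1/2)`. In any admissible numbering the indices belonging to a strip form a symmetric block,
hence are `0 < |j| ≤ n`. Consecutive strips place `Im λ_n` within `π/2` of `π n`, and this forces `k
= n`.

The same counts, with conjugation symmetry, produce a numbering: nonreal eigenvalues come in pairs,
so the real ones are even in number and fill the middle indices. -/

/-- Continuous functions on the unit interval. -/
abbrev CI := C(Icc (0 : ℝ) 1, ℂ)

theorem continuous_comp_projIcc (f : CI) :
    Continuous fun t : ℝ => f (projIcc 0 1 zero_le_one t) :=
  f.continuous.comp continuous_projIcc

/-- One integration raises the power and the factorial together. Iterating this is what makes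
Volterra operators quasinilpotent. -/
theorem norm_integral_projIcc_le (f : CI) {x C : ℝ} {n : ℕ} (hx : x ∈ Icc (0 : ℝ) 1)
    (h : ∀ t : Icc (0 : ℝ) 1, ‖f t‖ ≤ C * ((t : ℝ) ^ n / n.factorial)) :
    ‖∫ t in (0 : ℝ)..x, f (projIcc 0 1 zero_le_one t)‖ ≤
      C * (x ^ (n + 1) / (n + 1).factorial) := by
  have h1 : ‖∫ t in (0 : ℝ)..x, f (projIcc 0 1 zero_le_one t)‖ ≤
      ∫ t in (0 : ℝ)..x, C * (t ^ n / n.factorial) := by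
    refine intervalIntegral.norm_integral_le_of_norm_le hx.1 ?_ ?_
    · refine Filter.Eventually.of_forall fun t ht => ?_
      have ht' : t ∈ Icc (0 : ℝ) 1 := ⟨ht.1.le, ht.2.trans hx.2⟩
      have := h ⟨t, ht'⟩
      rwa [projIcc_of_mem _ ht']
    · exact (by fun_prop : Continuous fun t : ℝ => C * (t ^ n / n.factorial)).intervalIntegrable _ _
  refine h1.trans (le_of_eq ?_)
  rw [intervalIntegral.integral_const_mul, intervalIntegral.integral_div, integral_pow,
    Nat.factorial_succ]
  have : (n.factorial : ℝ) ≠ 0 := by positivity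
  push_cast
  field_simp
  simp

/-- The Volterra operator `f ↦ ∫₀ˣ f`. -/
noncomputable def volterra : CI →L[ℂ] CI :=
  LinearMap.mkContinuous
    { toFun := fun f =>
        { toFun := fun x => ∫ t in (0 : ℝ)..x, f (projIcc 0 1 zero_le_one t)
          continuous_toFun := by
            have := intervalIntegral.continuous_primitive (μ := MeasureTheory.volume)
              (fun a b => (continuous_comp_projIcc f).intervalIntegrable a b) 0
            exact this.comp continuous_subtype_val }
      map_add' := fun f g => by
        ext x
        exact intervalIntegral.integral_add ((continuous_comp_projIcc f).intervalIntegrable _ _)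
          ((continuous_comp_projIcc g).intervalIntegrable _ _)
      map_smul' := fun c f => by
        ext x
        exact intervalIntegral.integral_smul c _ } 1 (fun f => by
    rw [ContinuousMap.norm_le _ (by positivity)]
    intro x
    have := norm_integral_projIcc_le f (n := 0) (C := ‖f‖) x.2 (fun t => by
      simpa using f.norm_coe_le_norm t)
    refine this.trans ?_
    have hx := x.2
    simp only [zero_add, pow_one, Nat.factorial_one, Nat.cast_one, div_one, one_mul]
    exact mul_le_of_le_one_right (norm_nonneg _) hx.2)

theorem volterra_apply (f : CI) (x : Icc (0 : ℝ) 1) :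
    volterra f x = ∫ t in (0 : ℝ)..x, f (projIcc 0 1 zero_le_one t) := rfl

/-- The integral operator `f ↦ ∫₀ˣ ∫₀ˢ q f`. -/
noncomputable def volterraSq (q : CI) : CI →L[ℂ] CI :=
  volterra ∘L volterra ∘L ContinuousLinearMap.mul ℂ CI q

theorem volterraSq_apply (q f : CI) : volterraSq q f = volterra (volterra (q * f)) := rfl

theorem norm_volterraSq_pow_apply_le (q f : CI) (n : ℕ) (x : Icc (0 : ℝ) 1) :
    ‖(volterraSq q ^ n) f x‖ ≤ (‖q‖ ^ n * ‖f‖) * ((x : ℝ) ^ (2 * n) / (2 * n).factorial) := by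
  induction n generalizing x with
  | zero => simpa using f.norm_coe_le_norm x
  | succ n ih =>
    rw [pow_succ', mul_apply_eq_comp, volterraSq_apply, volterra_apply]
    have h1 : ∀ t : Icc (0 : ℝ) 1, ‖volterra (q * (volterraSq q ^ n) f) t‖ ≤
        (‖q‖ ^ (n + 1) * ‖f‖) * ((t : ℝ) ^ (2 * n + 1) / (2 * n + 1).factorial) := by
      intro t
      rw [volterra_apply]
      refine norm_integral_projIcc_le _ t.2 fun s => ?_
      rw [ContinuousMap.mul_apply, norm_mul]
      calc ‖q s‖ * ‖(volterraSq q ^ n) f s‖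
          ≤ ‖q‖ * ((‖q‖ ^ n * ‖f‖) * ((s : ℝ) ^ (2 * n) / (2 * n).factorial)) :=
            mul_le_mul (q.norm_coe_le_norm s) (ih s) (norm_nonneg _) (norm_nonneg _)
        _ = _ := by ring
    exact norm_integral_projIcc_le _ x.2 h1

/-- `1 - x` is a factor of `1 - x ^ n`, and it commutes with the cofactor, the geometric sum. -/
theorem isUnit_one_sub_of_isUnit_one_sub_pow {R : Type*} [Ring R] {x : R} {n : ℕ}
    (h : IsUnit (1 - x ^ n)) : IsUnit (1 - x) := by
  rw [← mul_neg_geom_sum x n] at h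
  exact ((Commute.isUnit_mul_iff (Commute.sum_right _ _ _ fun i _ =>
    ((Commute.one_left x).sub_left (Commute.refl x)).pow_right i)).1 h).1

theorem differentiable_inverse_one_sub {X : Type*} [NormedAddCommGroup X] [NormedSpace ℂ X]
    [CompleteSpace X] (k₁ k₂ k₃ : X →L[ℂ] X)
    (h : ∀ z : ℂ, IsUnit (1 - (z ^ 2 • k₁ + (2 * z) • k₂ - k₃))) (x : X) (L : X →L[ℂ] ℂ) :
    Differentiable ℂ fun z : ℂ =>
      L (Ring.inverse (1 - (z ^ 2 • k₁ + (2 * z) • k₂ - k₃)) x) := by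
  have h1 : Differentiable ℂ fun z : ℂ => 1 - (z ^ 2 • k₁ + (2 * z) • k₂ - k₃) := by fun_prop
  have h2 : Differentiable ℂ fun z : ℂ =>
      Ring.inverse (1 - (z ^ 2 • k₁ + (2 * z) • k₂ - k₃)) := fun z => (h1 z).inverse (h z)
  exact fun z => L.differentiableAt.comp z ((h2 z).clm_apply (differentiableAt_const x))

/-- No smallness of `q` is needed: the powers decay factorially, so some power has norm below one
and the Neumann series applies to that power. -/
theorem isUnit_one_sub_volterraSq (q : CI) : IsUnit (1 - volterraSq q) := by
  obtain ⟨n, hn⟩ : ∃ n : ℕ, ‖q‖ ^ n / n.factorial < 1 :=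
    ((FloorSemiring.tendsto_pow_div_factorial_atTop ‖q‖).eventually_lt_const one_pos).exists
  have h1 : ‖volterraSq q ^ n‖ ≤ ‖q‖ ^ n / n.factorial := by
    refine ContinuousLinearMap.opNorm_le_bound _ (by positivity) fun f => ?_
    rw [ContinuousMap.norm_le _ (by positivity)]
    intro x
    refine (norm_volterraSq_pow_apply_le q f n x).trans ?_
    have hx : ((x : ℝ) ^ (2 * n) / (2 * n).factorial) ≤ 1 / n.factorial := by
      have h2 : (n.factorial : ℝ) ≤ (2 * n).factorial := by
        exact_mod_cast Nat.factorial_le (by omega)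
      have : (0 : ℝ) < n.factorial := by positivity
      exact div_le_div₀ zero_le_one (pow_le_one₀ x.2.1 x.2.2) this h2
    calc _ ≤ (‖q‖ ^ n * ‖f‖) * (1 / n.factorial) := by gcongr
      _ = _ := by ring
  have h2 : IsUnit (1 - volterraSq q ^ n) := 
    isUnit_one_sub_of_norm_lt_one (x := volterraSq q ^ n) (h1.trans_lt hn)
  exact isUnit_one_sub_of_isUnit_one_sub_pow (R := CI →L[ℂ] CI) (x := volterraSq q) (n := n) h2

/-- The solution of `u'' = q u`, `u(0) = 0`, `u'(0) = 1`. -/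
noncomputable def cauchySol (q : CI) : CI :=
  Ring.inverse (1 - volterraSq q) (volterra 1)

theorem cauchySol_eq (q : CI) :
    cauchySol q = volterra (1 + volterra (q * cauchySol q)) := by
  have h := Ring.mul_inverse_cancel _ (isUnit_one_sub_volterraSq q)
  have h2 := congrArg (fun T : CI →L[ℂ] CI => T (volterra 1)) h
  simp only [mul_apply_eq_comp, sub_apply,
    one_apply_eq_self] at h2
  change cauchySol q - volterraSq q (cauchySol q) = volterra 1 at h2
  rw [map_add, ← h2, volterraSq_apply]
  abel

theorem hasDerivWithinAt_volterra (f : CI) {x : ℝ} (hx : x ∈ Icc (0 : ℝ) 1) :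
    HasDerivWithinAt (fun t => volterra f (projIcc 0 1 zero_le_one t))
      (f (projIcc 0 1 zero_le_one x)) (Icc 0 1) x := by
  have h1 : HasDerivAt (fun y => ∫ t in (0 : ℝ)..y, f (projIcc 0 1 zero_le_one t))
      (f (projIcc 0 1 zero_le_one x)) x :=
    intervalIntegral.integral_hasDerivAt_right
      ((continuous_comp_projIcc f).intervalIntegrable _ _)
      ((continuous_comp_projIcc f).stronglyMeasurableAtFilter _ _)
      (continuous_comp_projIcc f).continuousAt
  refine h1.hasDerivWithinAt.congr (fun y hy => ?_) ?_
  · rw [volterra_apply, projIcc_of_mem _ hy]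
  · rw [volterra_apply, projIcc_of_mem _ hx]

theorem volterra_projIcc_zero (f : CI) : volterra f (projIcc 0 1 zero_le_one 0) = 0 := by
  rw [volterra_apply, projIcc_left]; simp

/-- A real function continuous on `[0,1]` as a complex-valued continuous map. -/
noncomputable def toCI (a : ℝ → ℝ) (ha : ContinuousOn a (Icc 0 1)) : CI where
  toFun x := (a x : ℂ)
  continuous_toFun := Complex.continuous_ofReal.comp (continuousOn_iff_continuous_domRestrict.1 ha)

/-- The potential `z² + 2 z a - b`. -/
noncomputable def potential (A B : CI) (z : ℂ) : CI := z ^ 2 • (1 : CI) + (2 * z) • A - B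

theorem isSolution_cauchySol {a b : ℝ → ℝ} (ha : ContinuousOn a (Icc 0 1))
    (hb : ContinuousOn b (Icc 0 1)) (z : ℂ) :
    IsSolution a b z
      (fun x => cauchySol (potential (toCI a ha) (toCI b hb) z) (projIcc 0 1 zero_le_one x))
      (fun x => (1 + volterra (potential (toCI a ha) (toCI b hb) z *
        cauchySol (potential (toCI a ha) (toCI b hb) z))) (projIcc 0 1 zero_le_one x)) := by
  intro x hx
  set q := potential (toCI a ha) (toCI b hb) z with hq
  constructor
  · conv => arg 1; rw [cauchySol_eq q]
    exact hasDerivWithinAt_volterra _ hx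
  · have h := (hasDerivWithinAt_volterra (q * cauchySol q) hx).const_add 1
    refine h.congr_deriv ?_
    rw [ContinuousMap.mul_apply]
    congr 1
    rw [projIcc_of_mem _ hx]
    simp [hq, potential, toCI]

/-- Grönwall for the pair `(u, v)` in the sup norm, with constant `max C 1` where `C` bounds the
potential. -/
theorem IsSolution.eq_zero {a b : ℝ → ℝ} (ha : ContinuousOn a (Icc 0 1))
    (hb : ContinuousOn b (Icc 0 1)) {z : ℂ} {u v : ℝ → ℂ} (h : IsSolution a b z u v)
    (hu : u 0 = 0) (hv : v 0 = 0) : ∀ x ∈ Icc (0 : ℝ) 1, u x = 0 := by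
  have hQ : ContinuousOn (fun x : ℝ => z ^ 2 + 2 * z * (a x : ℂ) - (b x : ℂ)) (Icc 0 1) := by
    have := Complex.continuous_ofReal.comp_continuousOn ha
    have := Complex.continuous_ofReal.comp_continuousOn hb
    fun_prop
  obtain ⟨C, hC⟩ := isCompact_Icc.exists_bound_of_continuousOn hQ
  have key := eq_zero_of_abs_deriv_le_mul_abs_self_of_eq_zero_right
    (f := fun x => (u x, v x))
    (f' := fun x => (v x, (z ^ 2 + 2 * z * (a x : ℂ) - (b x : ℂ)) * u x))
    (K := max C 1) (a := 0) (b := 1)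
    (fun x hx => ((h x hx).1.continuousWithinAt.prodMk (h x hx).2.continuousWithinAt))
    (fun x hx => by
      have h1 := (h x (Ico_subset_Icc_self hx)).1.prodMk (h x (Ico_subset_Icc_self hx)).2
      have hmem : Icc (0 : ℝ) 1 ∈ 𝓝[Ici x] x := by
        refine mem_of_superset (Icc_mem_nhdsGE hx.2) (Icc_subset_Icc_left hx.1)
      exact h1.mono_of_mem_nhdsWithin hmem)
    (by simp [hu, hv])
    (fun x hx => by
      have hx' := hC x (Ico_subset_Icc_self hx)
      rw [Prod.norm_mk, Prod.norm_mk, norm_mul]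
      refine max_le ?_ ?_
      · calc ‖v x‖ = 1 * ‖v x‖ := (one_mul _).symm
          _ ≤ _ := mul_le_mul (le_max_right _ _) (le_max_right _ _) (norm_nonneg _)
            (zero_le_one.trans (le_max_right _ _))
      · exact mul_le_mul (hx'.trans (le_max_left _ _)) (le_max_left _ _) (norm_nonneg _)
            (zero_le_one.trans (le_max_right _ _)))
  intro x hx
  exact congrArg Prod.fst (key x hx)

theorem IsSolution.linear {a b : ℝ → ℝ} {z : ℂ} {u v u' v' : ℝ → ℂ} (h : IsSolution a b z u v)
    (h' : IsSolution a b z u' v') (c : ℂ) :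
    IsSolution a b z (fun x => u x - c * u' x) (fun x => v x - c * v' x) := by
  intro x hx
  refine ⟨(h x hx).1.sub ((h' x hx).1.const_mul c), ?_⟩
  exact ((h x hx).2.sub ((h' x hx).2.const_mul c)).congr_deriv (by ring)

/-! ### The characteristic function: uniqueness, analyticity, zeros, conjugation. -/

theorem exists_isSolution {a b : ℝ → ℝ} (ha : ContinuousOn a (Icc 0 1))
    (hb : ContinuousOn b (Icc 0 1)) (z : ℂ) :
    ∃ u v : ℝ → ℂ, IsSolution a b z u v ∧ u 0 = 0 ∧ v 0 = 1 ∧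
      u 1 = cauchySol (potential (toCI a ha) (toCI b hb) z) ⟨1, by simp⟩ := by
  refine ⟨_, _, isSolution_cauchySol ha hb z, ?_, ?_, ?_⟩
  · rw [cauchySol_eq]; exact volterra_projIcc_zero _
  · change 1 + volterra _ _ = (1 : ℂ)
    rw [volterra_projIcc_zero, add_zero]
  · simp [projIcc_right]

/-- Uniqueness of the initial value problem makes the choice in `charFun` immaterial, so any
solution may be used to compute it. -/
theorem charFun_eq {a b : ℝ → ℝ} (ha : ContinuousOn a (Icc 0 1))
    (hb : ContinuousOn b (Icc 0 1)) {z : ℂ} {u v : ℝ → ℂ} (h : IsSolution a b z u v)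
    (hu : u 0 = 0) (hv : v 0 = 1) : charFun a b z = u 1 := by
  have hex : ∃ w : ℂ, ∃ u v : ℝ → ℂ, IsSolution a b z u v ∧ u 0 = 0 ∧ v 0 = 1 ∧ u 1 = w :=
    ⟨u 1, u, v, h, hu, hv, rfl⟩
  obtain ⟨u', v', h', hu', hv', he⟩ := Classical.epsilon_spec hex
  have h0 := (h.linear h' 1).eq_zero ha hb (by simp [hu, hu']) (by simp [hv, hv']) 1 (by simp)
  have : u 1 = u' 1 := by simpa [sub_eq_zero] using h0
  rw [this, he]; rfl

theorem charFun_eq_cauchySol {a b : ℝ → ℝ} (ha : ContinuousOn a (Icc 0 1))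
    (hb : ContinuousOn b (Icc 0 1)) (z : ℂ) :
    charFun a b z = cauchySol (potential (toCI a ha) (toCI b hb) z) ⟨1, by simp⟩ := by
  obtain ⟨u, v, h, hu, hv, h1⟩ := exists_isSolution ha hb z
  rw [charFun_eq ha hb h hu hv, h1]

/-- The integral operator is a quadratic polynomial in `z`. Inversion is analytic on invertible
operators, and evaluation at `1` is a continuous functional. -/
theorem differentiable_charFun {a b : ℝ → ℝ} (ha : ContinuousOn a (Icc 0 1))
    (hb : ContinuousOn b (Icc 0 1)) : Differentiable ℂ (charFun a b) := by
  have h1 : ∀ z, volterraSq (potential (toCI a ha) (toCI b hb) z) =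
      z ^ 2 • volterraSq 1 + (2 * z) • volterraSq (toCI a ha) - volterraSq (toCI b hb) := by
    intro z
    ext1 f
    change volterra (volterra (potential (toCI a ha) (toCI b hb) z * f)) =
      z ^ 2 • volterra (volterra (1 * f)) + (2 * z) • volterra (volterra (toCI a ha * f)) -
        volterra (volterra (toCI b hb * f))
    simp only [potential, sub_mul, add_mul, smul_mul_assoc, map_add, map_sub, map_smul]
  have h2 := differentiable_inverse_one_sub (volterraSq 1) (volterraSq (toCI a ha))
    (volterraSq (toCI b hb)) (fun z => h1 z ▸ isUnit_one_sub_volterraSq _) (volterra 1)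
    (ContinuousMap.evalCLM ℂ (⟨1, by simp⟩ : Icc (0 : ℝ) 1))
  have he : charFun a b = _ := funext fun z => (charFun_eq_cauchySol ha hb z).trans (by
    rw [cauchySol, h1])
  rw [he]
  exact h2

/-- By uniqueness an eigenfunction is a nonzero multiple of the normalized solution. Conversely that
solution is not identically zero, because its derivative at `0` is `1`. -/
theorem isEigenvalue_iff {a b : ℝ → ℝ} (ha : ContinuousOn a (Icc 0 1))
    (hb : ContinuousOn b (Icc 0 1)) (z : ℂ) : IsEigenvalue a b z ↔ charFun a b z = 0 := by
  obtain ⟨u, v, h, hu, hv, -⟩ := exists_isSolution ha hb z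
  rw [charFun_eq ha hb h hu hv]
  constructor
  · rintro ⟨u', v', h', hu0, hu1, x, hx, hne⟩
    have h0 := (h'.linear h (v' 0)).eq_zero ha hb (by simp [hu0, hu]) (by simp [hv])
    have hc : v' 0 ≠ 0 := by
      intro hc
      have := h0 x hx
      rw [hc] at this
      exact hne (by simpa using this)
    have := h0 1 (by simp)
    rw [hu1, zero_sub, neg_eq_zero] at this
    exact (mul_eq_zero.1 this).resolve_left hc
  · intro h1
    refine ⟨u, v, h, hu, h1, ?_⟩
    by_contra! hcon
    have hd := (h 0 (by simp)).1
    have hd' : HasDerivWithinAt u 0 (Icc 0 1) 0 :=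
      (hasDerivWithinAt_const (0 : ℝ) (Icc (0 : ℝ) 1) (0 : ℂ)).congr
        (fun y hy => hcon y hy) (hcon 0 (by simp))
    have := (uniqueDiffOn_Icc (zero_lt_one' ℝ) 0 (by simp)).eq_deriv _ hd hd'
    rw [hv] at this
    exact one_ne_zero this

/-- As `a` and `b` are real, conjugating a solution for `z` gives the solution for the conjugate
parameter. -/
theorem charFun_conj {a b : ℝ → ℝ} (ha : ContinuousOn a (Icc 0 1))
    (hb : ContinuousOn b (Icc 0 1)) (z : ℂ) :
    charFun a b ((starRingEnd ℂ) z) = (starRingEnd ℂ) (charFun a b z) := by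
  obtain ⟨u, v, h, hu, hv, -⟩ := exists_isSolution ha hb z
  have h' : IsSolution a b ((starRingEnd ℂ) z) (fun x => (starRingEnd ℂ) (u x))
      (fun x => (starRingEnd ℂ) (v x)) := by
    intro x hx
    have hconj : ∀ {f : ℝ → ℂ} {f' : ℂ}, HasDerivWithinAt f f' (Icc 0 1) x →
        HasDerivWithinAt (fun y => (starRingEnd ℂ) (f y)) ((starRingEnd ℂ) f') (Icc 0 1) x := by
      intro f f' hf
      exact (Complex.conjCLE.toContinuousLinearMap.hasFDerivAt.comp_hasDerivWithinAt x hf)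
    refine ⟨hconj (h x hx).1, ?_⟩
    convert hconj (h x hx).2 using 1
    simp only [map_mul, map_sub, map_add, map_pow, Complex.conj_ofReal, Complex.conj_ofNat]
  rw [charFun_eq ha hb h hu hv, charFun_eq ha hb h' (by simp [hu]) (by simp [hv])]

/-! ### The argument principle and Rouché's theorem for entire functions on discs -/

theorem finite_zeros_closedBall {f : ℂ → ℂ} (hf : Differentiable ℂ f) {p : ℂ} (hp : f p ≠ 0)
    (c : ℂ) (R : ℝ) : {z | z ∈ Metric.closedBall c R ∧ f z = 0}.Finite := by
  have h := AnalyticOnNhd.preimage_zero_mem_codiscrete (f := f) (x := p)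
    (fun z _ => hf.analyticAt z) hp
  refine ((isCompact_closedBall c R).finite_sdiff_of_mem_codiscreteWithin
    (Filter.codiscreteWithin_mono (subset_univ _) h)).subset fun z hz => ⟨hz.1, ?_⟩
  simpa using hz.2

theorem analyticOrderAt_ne_top_of_entire {f : ℂ → ℂ} (hf : Differentiable ℂ f) {p : ℂ}
    (hp : f p ≠ 0) (w : ℂ) : analyticOrderAt f w ≠ ⊤ := by
  refine AnalyticOnNhd.analyticOrderAt_ne_top_of_isPreconnected (U := univ) (x := p)
    (fun z _ => hf.analyticAt z) isPreconnected_univ (mem_univ _) (mem_univ _) ?_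
  rw [(hf.analyticAt p).analyticOrderAt_eq_zero.2 hp]
  exact ENat.zero_ne_top

/-- The cofactor is entire, not merely a local germ, so zeros can be split off one after another
within the class of entire functions. -/
theorem exists_eq_pow_order_mul {f : ℂ → ℂ} (hf : Differentiable ℂ f) {p : ℂ} (hp : f p ≠ 0)
    (w : ℂ) : ∃ g : ℂ → ℂ, Differentiable ℂ g ∧ g w ≠ 0 ∧
      ∀ z, f z = (z - w) ^ analyticOrderNatAt f w * g z := by
  set n := analyticOrderNatAt f w
  have hn : analyticOrderAt f w = n :=
    (Nat.cast_analyticOrderNatAt (analyticOrderAt_ne_top_of_entire hf hp w)).symm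
  obtain ⟨g, hg, hgw, he⟩ := ((hf.analyticAt w).analyticOrderAt_eq_natCast).1 hn
  -- The quotient is used everywhere except at `w`; the local factor only fills in the removable
  -- singularity.
  refine ⟨Function.update (fun z => f z / (z - w) ^ n) w (g w), ?_, by simpa using hgw, ?_⟩
  · intro z
    rcases eq_or_ne z w with rfl | hz
    · refine hg.differentiableAt.congr_of_eventuallyEq ?_
      filter_upwards [he] with y hy
      rcases eq_or_ne y z with rfl | hyz
      · simp
      · rw [Function.update_of_ne hyz, hy, smul_eq_mul, mul_div_cancel_left₀]
        exact pow_ne_zero _ (sub_ne_zero.2 hyz)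
    · have : DifferentiableAt ℂ (fun z => f z / (z - w) ^ n) z :=
        (hf z).div ((differentiableAt_id.sub_const w).pow n) (pow_ne_zero _ (sub_ne_zero.2 hz))
      refine this.congr_of_eventuallyEq ?_
      filter_upwards [isOpen_ne.mem_nhds hz] with y hy
      rw [Function.update_of_ne hy]
  · intro z
    rcases eq_or_ne z w with rfl | hz
    · simpa using he.self_of_nhds
    · rw [Function.update_of_ne hz, mul_div_cancel₀]
      exact pow_ne_zero _ (sub_ne_zero.2 hz)

theorem continuousOn_logDeriv {f : ℂ → ℂ} (hf : Differentiable ℂ f) {s : Set ℂ}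
    (hs : ∀ z ∈ s, f z ≠ 0) : ContinuousOn (logDeriv f) s :=
  (hf.contDiff.continuous_deriv (n := 1) le_rfl).continuousOn.div hf.continuous.continuousOn hs

/-- Each zero of order `n` is split off and adds `n / (z - w)` to the logarithmic derivative without
changing the other orders. Once no zero is left, Cauchy's theorem gives `0`. -/
theorem circleIntegral_logDeriv_eq_sum {c : ℂ} {R : ℝ} (hR : 0 < R) (Z : Finset ℂ)
    {f : ℂ → ℂ} (hf : Differentiable ℂ f) (hs : ∀ z ∈ Metric.sphere c R, f z ≠ 0)
    (hZ : ∀ z, z ∈ Z ↔ z ∈ Metric.ball c R ∧ f z = 0) :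
    (∮ z in C(c, R), logDeriv f z) =
      2 * Real.pi * Complex.I * ((∑ w ∈ Z, analyticOrderNatAt f w : ℕ) : ℂ) := by
  induction Z using Finset.induction_on generalizing f with
  | empty =>
    have hne : ∀ z ∈ Metric.closedBall c R, f z ≠ 0 := by
      intro z hz h0
      rcases (Metric.mem_closedBall.1 hz).lt_or_eq with h | h
      · simpa using (hZ z).2 ⟨h, h0⟩
      · exact hs z h h0
    rw [Finset.sum_empty, Nat.cast_zero, mul_zero]
    refine Complex.circleIntegral_eq_zero_of_differentiable_on_off_countable hR.le
      countable_empty (continuousOn_logDeriv hf hne) fun z hz => ?_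
    exact ((hf.analyticAt z).deriv.differentiableAt).div (hf z)
      (hne z (Metric.ball_subset_closedBall hz.1))
  | insert w Z hw ih =>
    have hp : f (c + R) ≠ 0 := hs _ (by simp [abs_of_pos hR])
    obtain ⟨g, hg, hgw, hfg⟩ := exists_eq_pow_order_mul hf hp w
    set n := analyticOrderNatAt f w with hn
    have hwb : w ∈ Metric.ball c R := ((hZ w).1 (Finset.mem_insert_self _ _)).1
    have hgs : ∀ z ∈ Metric.sphere c R, g z ≠ 0 := fun z hz h0 => hs z hz (by rw [hfg, h0, mul_zero])
    have hne : ∀ z ∈ Metric.sphere c R, z - w ≠ 0 := by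
      intro z hz h0
      rw [sub_eq_zero] at h0
      rw [h0] at hz
      exact (Metric.mem_ball.1 hwb).ne (Metric.mem_sphere.1 hz)
    have hn0 : n ≠ 0 := by
      intro h0
      have := ((hZ w).1 (Finset.mem_insert_self _ _)).2
      rw [hfg, h0, pow_zero, one_mul] at this
      exact hgw this
    have hgZ : ∀ z, z ∈ Z ↔ z ∈ Metric.ball c R ∧ g z = 0 := by
      intro z
      constructor
      · intro hz
        have h1 := (hZ z).1 (Finset.mem_insert_of_mem hz)
        refine ⟨h1.1, ?_⟩
        have h2 := h1.2
        rw [hfg, mul_eq_zero] at h2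
        refine h2.resolve_left (pow_ne_zero _ (sub_ne_zero.2 ?_))
        rintro rfl; exact hw hz
      · rintro ⟨h1, h2⟩
        have h3 := (hZ z).2 ⟨h1, by rw [hfg, h2, mul_zero]⟩
        rcases Finset.mem_insert.1 h3 with rfl | h3
        · exact absurd h2 hgw
        · exact h3
    have hord : ∀ z ∈ Z, analyticOrderNatAt f z = analyticOrderNatAt g z := by
      intro z hz
      have hzw : z - w ≠ 0 := sub_ne_zero.2 (by rintro rfl; exact hw hz)
      have hfe : f = (fun z => (z - w) ^ n) * g := funext hfg
      have ha : AnalyticAt ℂ (fun z : ℂ => (z - w) ^ n) z := by fun_prop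
      have h1 : analyticOrderAt f z = analyticOrderAt g z := by
        rw [hfe, analyticOrderAt_mul ha (hg.analyticAt z),
          ha.analyticOrderAt_eq_zero.2 (pow_ne_zero _ hzw), zero_add]
      simp only [analyticOrderNatAt, h1]
    have hcongr : ∀ z ∈ Metric.sphere c R,
        logDeriv f z = n * (z - w)⁻¹ + logDeriv g z := by
      intro z hz
      have hfe : f = fun z => (z - w) ^ n * g z := funext hfg
      have hd : DifferentiableAt ℂ (fun y : ℂ => y - w) z := by fun_prop
      rw [hfe, logDeriv_mul (f := fun y => (y - w) ^ n) z (pow_ne_zero n (hne z hz)) (hgs z hz)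
        (hd.pow n) (hg z), logDeriv_fun_pow hd]
      congr 2
      simp [logDeriv_apply]
    rw [circleIntegral.integral_congr hR.le hcongr, circleIntegral.integral_add,
      circleIntegral.integral_const_mul, circleIntegral.integral_sub_inv_of_mem_ball hwb,
      ih hg hgs hgZ, Finset.sum_insert hw, Finset.sum_congr rfl hord]
    · push_cast; ring
    · refine ContinuousOn.circleIntegrable hR.le ?_
      exact continuousOn_const.mul ((continuousOn_id.sub continuousOn_const).inv₀ hne)
    · exact (continuousOn_logDeriv hg hgs).circleIntegrable hR.le

/-- **Rouché's theorem** for entire functions on a disc. -/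
theorem rouche {c : ℂ} {R : ℝ} (hR : 0 < R) {f g : ℂ → ℂ} (hf : Differentiable ℂ f)
    (hg : Differentiable ℂ g) (h : ∀ z ∈ Metric.sphere c R, ‖f z - g z‖ < ‖g z‖)
    {Zf Zg : Finset ℂ} (hZf : ∀ z, z ∈ Zf ↔ z ∈ Metric.ball c R ∧ f z = 0)
    (hZg : ∀ z, z ∈ Zg ↔ z ∈ Metric.ball c R ∧ g z = 0) :
    ∑ w ∈ Zf, analyticOrderNatAt f w = ∑ w ∈ Zg, analyticOrderNatAt g w := by
  have hgs : ∀ z ∈ Metric.sphere c R, g z ≠ 0 := fun z hz h0 => by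
    have := h z hz
    rw [h0, norm_zero] at this
    exact absurd this (norm_nonneg _).not_gt
  have hfs : ∀ z ∈ Metric.sphere c R, f z ≠ 0 := fun z hz h0 => by
    have := h z hz
    rw [h0, zero_sub, norm_neg] at this
    exact lt_irrefl _ this
  -- On the circle `f / g` stays in the unit disc about `1`, so the principal logarithm of `f / g`
  -- is a single-valued primitive of the integrand.
  have h0 : (∮ z in C(c, R), (logDeriv f z - logDeriv g z)) = 0 := by
    refine circleIntegral.integral_eq_zero_of_hasDerivWithinAt hR.le
      (f := fun z => Complex.log (f z / g z)) fun z hz => HasDerivAt.hasDerivWithinAt ?_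
    have hd : HasDerivAt (fun z => f z / g z) _ z := (hf z).hasDerivAt.div (hg z).hasDerivAt (hgs z hz)
    have hslit : f z / g z ∈ Complex.slitPlane := by
      have : f z / g z = 1 + (f z - g z) / g z := by field_simp [hgs z hz]; ring
      rw [this]
      refine Complex.mem_slitPlane_of_norm_lt_one ?_
      rw [norm_div, div_lt_one (norm_pos_iff.2 (hgs z hz))]
      exact h z hz
    refine (hd.clog hslit).congr_deriv ?_
    rw [logDeriv_apply, logDeriv_apply]
    field_simp [hgs z hz, hfs z hz]
  rw [circleIntegral.integral_sub ((continuousOn_logDeriv hf hfs).circleIntegrable hR.le)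
    ((continuousOn_logDeriv hg hgs).circleIntegrable hR.le),
    circleIntegral_logDeriv_eq_sum hR Zf hf hfs hZf,
    circleIntegral_logDeriv_eq_sum hR Zg hg hgs hZg, ← mul_sub] at h0
  have h1 := (mul_eq_zero.1 h0).resolve_left Complex.two_pi_I_ne_zero
  exact_mod_cast sub_eq_zero.1 h1

/-! ### WKB approximation -/

theorem contDiffOn_D {f : ℝ → ℝ} {n : ℕ} (hf : ContDiffOn ℝ ((n + 1 : ℕ) : ℕ∞) f (Icc 0 1)) :
    ContDiffOn ℝ (n : ℕ∞) (D f) (Icc 0 1) :=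
  hf.derivWithin (uniqueDiffOn_Icc zero_lt_one) (by norm_cast)

theorem hasDerivWithinAt_D {f : ℝ → ℝ} {n : ℕ}
    (hf : ContDiffOn ℝ ((n + 1 : ℕ) : ℕ∞) f (Icc 0 1)) {x : ℝ} (hx : x ∈ Icc (0 : ℝ) 1) :
    HasDerivWithinAt f (D f x) (Icc 0 1) x :=
  ((hf.differentiableOn (by simp)) x hx).hasDerivWithinAt

/-- Each step of the recursion costs one derivative, and `b`, with one derivative fewer than `a`,
enters at `i = 1`. Thus the terms with `i < m` retain at least two derivatives. -/
theorem contDiffOn_phi {m : ℕ} {a b : ℝ → ℝ}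
    (ha : ContDiffOn ℝ ((m + 1 : ℕ) : ℕ∞) a (Icc (0 : ℝ) 1))
    (hb : ContDiffOn ℝ (m : ℕ∞) b (Icc (0 : ℝ) 1)) (s : ℝ) (i k : ℕ) (h : i + k = m + 1) :
    ContDiffOn ℝ (k : ℕ∞) (phi s a b i) (Icc 0 1) := by
  induction i using Nat.strong_induction_on generalizing k with
  | _ i ih =>
    match i with
    | 0 =>
      rw [phi]
      obtain rfl : k = m + 1 := by omega
      exact ha
    | 1 =>
      rw [phi]
      obtain rfl : k = m := by omega
      have h1 := contDiffOn_D ha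
      have h2 : ContDiffOn ℝ (k : ℕ∞) a (Icc 0 1) := ha.of_le (by norm_cast; omega)
      exact contDiffOn_const.mul (((contDiffOn_const.mul h1).add (h2.pow 2)).add hb)
    | i + 2 =>
      rw [phi]
      have h1 := contDiffOn_D (ih (i + 1) (by omega) (k + 1) (by omega))
      have h2 : ∀ j, j < i + 2 → ContDiffOn ℝ (k : ℕ∞) (phi s a b j) (Icc 0 1) := fun j hj =>
        (ih j hj (m + 1 - j) (by omega)).of_le (by norm_cast; omega)
      exact contDiffOn_const.mul ((contDiffOn_const.mul h1).add
        (ContDiffOn.sum fun j _ => (h2 j j.2).mul (h2 _ (by omega))))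

theorem two_mul_phi_one_add (s : ℝ) (a b : ℝ → ℝ) (x : ℝ) :
    2 * phi s a b 1 x + s * D (phi s a b 0) x + phi s a b 0 x * phi s a b 0 x = -b x := by
  rw [phi, phi]; ring

theorem two_mul_phi_add_two_add (s : ℝ) (a b : ℝ → ℝ) (i : ℕ) (x : ℝ) :
    2 * phi s a b (i + 2) x + s * D (phi s a b (i + 1)) x +
      ∑ j ∈ Finset.range (i + 2), phi s a b j x * phi s a b (i + 1 - j) x = 0 := by
  rw [phi, ← Fin.sum_univ_eq_sum_range (fun j => phi s a b j x * phi s a b (i + 1 - j) x)]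
  ring

/-- The square of a polynomial of degree at most `k`, with the terms of degree at least `k`
separated. -/
theorem sum_range_sq_eq {R : Type*} [CommRing R] (c : ℕ → R) (X : R) (k : ℕ) :
    (∑ i ∈ Finset.range (k + 1), c i * X ^ i) ^ 2 =
      ∑ l ∈ Finset.range k, (∑ j ∈ Finset.range (l + 1), c j * c (l - j)) * X ^ l +
        X ^ k * ∑ p ∈ (Finset.range (k + 1) ×ˢ Finset.range (k + 1)) with k ≤ p.1 + p.2,
          c p.1 * c p.2 * X ^ (p.1 + p.2 - k) := by
  rw [sq, Finset.sum_mul_sum, ← Finset.sum_product',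
    ← Finset.sum_filter_add_sum_filter_not _ (fun p : ℕ × ℕ => p.1 + p.2 < k)]
  congr 1
  · rw [← Finset.sum_fiberwise_of_maps_to (g := fun p : ℕ × ℕ => p.1 + p.2) (t := Finset.range k)]
    · refine Finset.sum_congr rfl fun l hl => ?_
      rw [Finset.sum_mul]
      refine Finset.sum_nbij' (fun p => p.1) (fun j => (j, l - j)) ?_ ?_ ?_ ?_ ?_
      · simp only [Finset.mem_filter, Finset.mem_product, Finset.mem_range]; omega
      · intro j hj
        simp only [Finset.mem_filter, Finset.mem_product, Finset.mem_range] at hl hj ⊢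
        refine ⟨⟨⟨?_, ?_⟩, ?_⟩, ?_⟩ <;> omega
      · rintro ⟨i, j⟩ h
        simp only [Finset.mem_filter, Finset.mem_product, Finset.mem_range] at h
        obtain ⟨-, rfl⟩ := h
        simp
      · simp
      · rintro ⟨i, j⟩ h
        simp only [Finset.mem_filter, Finset.mem_product, Finset.mem_range] at h ⊢
        obtain ⟨-, rfl⟩ := h
        rw [Nat.add_sub_cancel_left]; ring
    · simp
  · rw [Finset.mul_sum]
    refine Finset.sum_congr (by ext; simp) fun p hp => ?_
    have h : k ≤ p.1 + p.2 := by simpa using (Finset.mem_filter.1 hp).2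
    obtain ⟨d, hd⟩ := Nat.exists_eq_add_of_le h
    rw [hd, Nat.add_sub_cancel_left]
    have : X ^ p.1 * X ^ p.2 = X ^ k * X ^ d := by rw [← pow_add, ← pow_add, hd]
    linear_combination (c p.1 * c p.2) * this

/-- The WKB correction `∑_{i<m} φ_i z^{-i}`, as a function of `X = z⁻¹`. -/
noncomputable def wkb (s : ℝ) (a b : ℝ → ℝ) (m : ℕ) (X : ℂ) (x : ℝ) : ℂ :=
  ∑ i ∈ Finset.range m, (phi s a b i x : ℂ) * X ^ i

/-- The derivative of `wkb`. -/
noncomputable def wkbDeriv (s : ℝ) (a b : ℝ → ℝ) (m : ℕ) (X : ℂ) (x : ℝ) : ℂ :=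
  ∑ i ∈ Finset.range m, (D (phi s a b i) x : ℂ) * X ^ i

/-- The residual of the truncated WKB ansatz, divided by `z^{1-m}`, for `m = k + 1`. -/
noncomputable def wkbResidual (s : ℝ) (a b : ℝ → ℝ) (k : ℕ) (X : ℂ) (x : ℝ) : ℂ :=
  (if k = 0 then (b x : ℂ) else 0) + s * D (phi s a b k) x +
    ∑ p ∈ (Finset.range (k + 1) ×ˢ Finset.range (k + 1)) with k ≤ p.1 + p.2,
      (phi s a b p.1 x : ℂ) * phi s a b p.2 x * X ^ (p.1 + p.2 - k)

/-- The recursion cancels the coefficients of `z^{-l}` for `l < k`. At order `z^{-k}` the term `2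
φ_{k+1}` that would continue the cancellation is absent. For `k = 0` the missing `φ_1` is also the
term that would produce `-b`, which is why the residual then contains `b`. -/
theorem riccati_wkb (s : ℝ) (a b : ℝ → ℝ) (k : ℕ) {z : ℂ} (hz : z ≠ 0) (x : ℝ) :
    s * wkbDeriv s a b (k + 1) z⁻¹ x + (z + wkb s a b (k + 1) z⁻¹ x) ^ 2 =
      z ^ 2 + 2 * z * a x - b x + z⁻¹ ^ k * wkbResidual s a b k z⁻¹ x := by
  have h1 : 2 * z * wkb s a b (k + 1) z⁻¹ x =
      2 * z * a x + ∑ l ∈ Finset.range k, 2 * (phi s a b (l + 1) x : ℂ) * z⁻¹ ^ l := by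
    rw [wkb, Finset.sum_range_succ', mul_add, add_comm, Finset.mul_sum]
    congr 1
    · rw [phi]; simp
    · refine Finset.sum_congr rfl fun l _ => ?_
      rw [pow_succ]; field_simp
  have h2 : (wkb s a b (k + 1) z⁻¹ x) ^ 2 = _ :=
    sum_range_sq_eq (fun i => (phi s a b i x : ℂ)) z⁻¹ k
  have h3 : (s : ℂ) * wkbDeriv s a b (k + 1) z⁻¹ x =
      ∑ l ∈ Finset.range k, s * (D (phi s a b l) x : ℂ) * z⁻¹ ^ l +
        s * (D (phi s a b k) x : ℂ) * z⁻¹ ^ k := by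
    rw [wkbDeriv, Finset.sum_range_succ, mul_add, Finset.mul_sum]
    simp only [mul_assoc]
  have h4 : ∑ l ∈ Finset.range k, 2 * (phi s a b (l + 1) x : ℂ) * z⁻¹ ^ l +
      ∑ l ∈ Finset.range k, s * (D (phi s a b l) x : ℂ) * z⁻¹ ^ l +
      ∑ l ∈ Finset.range k, (∑ j ∈ Finset.range (l + 1),
        (phi s a b j x : ℂ) * phi s a b (l - j) x) * z⁻¹ ^ l =
      -b x + z⁻¹ ^ k * if k = 0 then (b x : ℂ) else 0 := by
    rw [← Finset.sum_add_distrib, ← Finset.sum_add_distrib]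
    cases k with
    | zero => simp
    | succ k =>
      rw [Finset.sum_range_succ', Finset.sum_eq_zero]
      · have := two_mul_phi_one_add s a b x
        have h : (2 * phi s a b 1 x + s * D (phi s a b 0) x + phi s a b 0 x * phi s a b 0 x : ℂ) =
          -b x := by exact_mod_cast this
        simp only [zero_add, pow_zero, mul_one, Finset.sum_range_one, Nat.sub_zero,
          Nat.add_eq_zero_iff, one_ne_zero, and_false, if_false, mul_zero, add_zero]
        exact h
      · intro l _
        have := two_mul_phi_add_two_add s a b l x
        have h := congrArg Complex.ofReal this
        push_cast at h
        rw [← add_mul, ← add_mul]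
        rw [show l + 1 + 1 = l + 2 from rfl, h, zero_mul]
  rw [add_sq, h1, h2, h3, wkbResidual]
  linear_combination h4

theorem continuousOn_wkb {s : ℝ} {a b : ℝ → ℝ} {m : ℕ}
    (h : ∀ i < m, ContinuousOn (phi s a b i) (Icc 0 1)) (t : Set ℂ) :
    ContinuousOn (fun p : ℂ × ℝ => wkb s a b m p.1 p.2) (t ×ˢ Icc 0 1) := by
  refine continuousOn_finsetSum _ fun i hi => ContinuousOn.mul ?_ (by fun_prop)
  exact Complex.continuous_ofReal.comp_continuousOn
    ((h i (Finset.mem_range.1 hi)).comp continuousOn_snd fun p hp => hp.2)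

theorem continuousOn_wkbResidual {s : ℝ} {a b : ℝ → ℝ} {k : ℕ}
    (h : ∀ i < k + 1, ContinuousOn (phi s a b i) (Icc 0 1))
    (h' : ContinuousOn (D (phi s a b k)) (Icc 0 1)) (hb : ContinuousOn b (Icc 0 1)) (t : Set ℂ) :
    ContinuousOn (fun p : ℂ × ℝ => wkbResidual s a b k p.1 p.2) (t ×ˢ Icc 0 1) := by
  have hc : ∀ {f : ℝ → ℝ}, ContinuousOn f (Icc 0 1) →
      ContinuousOn (fun p : ℂ × ℝ => (f p.2 : ℂ)) (t ×ˢ Icc 0 1) := fun hf =>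
    Complex.continuous_ofReal.comp_continuousOn (hf.comp continuousOn_snd fun p hp => hp.2)
  refine ContinuousOn.add (ContinuousOn.add ?_ (continuousOn_const.mul (hc h'))) ?_
  · split_ifs
    · exact hc hb
    · exact continuousOn_const
  · refine continuousOn_finsetSum _ fun q hq => ContinuousOn.mul ?_ (by fun_prop)
    have hq' := Finset.mem_product.1 (Finset.mem_filter.1 hq).1
    exact (hc (h _ (Finset.mem_range.1 hq'.1))).mul (hc (h _ (Finset.mem_range.1 hq'.2)))

/-- Bounds uniform in large `z` come from compactness: `X = z⁻¹` ranges over the closed unit disc,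
including `X = 0`. -/
theorem exists_norm_le_of_continuousOn {f : ℂ → ℝ → ℂ}
    (hf : ContinuousOn (fun p : ℂ × ℝ => f p.1 p.2) (Metric.closedBall 0 1 ×ˢ Icc 0 1)) :
    ∃ B, ∀ z : ℂ, 1 ≤ ‖z‖ → ∀ x ∈ Icc (0 : ℝ) 1, ‖f z⁻¹ x‖ ≤ B := by
  obtain ⟨B, hB⟩ := ((isCompact_closedBall (0 : ℂ) 1).prod
    isCompact_Icc).exists_bound_of_continuousOn hf
  refine ⟨B, fun z hz x hx => hB (z⁻¹, x) ⟨?_, hx⟩⟩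
  rw [mem_closedBall_zero_iff, norm_inv]
  exact inv_le_one_of_one_le₀ hz

theorem hasDerivWithinAt_wkb {s : ℝ} {a b : ℝ → ℝ} {m : ℕ}
    (h : ∀ i < m, ∀ x ∈ Icc (0 : ℝ) 1,
      HasDerivWithinAt (phi s a b i) (D (phi s a b i) x) (Icc 0 1) x)
    (X : ℂ) {x : ℝ} (hx : x ∈ Icc (0 : ℝ) 1) :
    HasDerivWithinAt (wkb s a b m X) (wkbDeriv s a b m X x) (Icc 0 1) x := by
  unfold wkb wkbDeriv
  exact HasDerivWithinAt.fun_sum fun i hi =>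
    ((h i (Finset.mem_range.1 hi) x hx).ofReal_comp).mul_const _

theorem exists_primitive {f : ℝ → ℂ} (hf : ContinuousOn f (Icc 0 1)) :
    ∃ F : ℝ → ℂ, F 0 = 0 ∧ F 1 = ∫ x in (0 : ℝ)..1, f x ∧
      ∀ x ∈ Icc (0 : ℝ) 1, HasDerivWithinAt F (f x) (Icc 0 1) x := by
  let f' : CI := ⟨_, continuousOn_iff_continuous_domRestrict.1 hf⟩
  refine ⟨fun x => volterra f' (projIcc 0 1 zero_le_one x), volterra_projIcc_zero _, ?_, ?_⟩
  · simp only [projIcc_right, volterra_apply]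
    refine intervalIntegral.integral_congr fun x hx => ?_
    rw [uIcc_of_le zero_le_one] at hx
    simp only [projIcc_of_mem _ hx]
    rfl
  · intro x hx
    have := hasDerivWithinAt_volterra f' hx
    rw [projIcc_of_mem _ hx] at this
    exact this

/-- Perturbation of the decoupled system `f' = 0`, `h' = -T' h` with bounded propagator. -/
theorem norm_sub_le_of_perturbed_system {f h τ T r₁ r₂ : ℝ → ℂ} {ε C : ℝ} (hC : 0 ≤ C)
    (hf : ∀ x ∈ Icc (0 : ℝ) 1, HasDerivWithinAt f (r₁ x * (f x + h x)) (Icc 0 1) x)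
    (hh : ∀ x ∈ Icc (0 : ℝ) 1, HasDerivWithinAt h (-τ x * h x + r₂ x * (f x + h x)) (Icc 0 1) x)
    (hT : ∀ x ∈ Icc (0 : ℝ) 1, HasDerivWithinAt T (τ x) (Icc 0 1) x) (hT0 : T 0 = 0)
    (hf0 : ‖f 0‖ ≤ 1) (hh0 : ‖h 0‖ ≤ 1)
    (hr₁ : ∀ x ∈ Icc (0 : ℝ) 1, ‖r₁ x‖ ≤ ε) (hr₂ : ∀ x ∈ Icc (0 : ℝ) 1, ‖r₂ x‖ ≤ ε)
    (hexp : ∀ t x, 0 ≤ t → t ≤ x → x ≤ 1 → ‖Complex.exp (T t - T x)‖ ≤ C)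
    (hε : (1 + C) * ε ≤ 1 / 2) :
    ‖f 1 + h 1 - (f 0 + Complex.exp (-T 1) * h 0)‖ ≤ 2 * (1 + C) ^ 2 * ε := by
  have hε0 : 0 ≤ ε := (norm_nonneg _).trans (hr₁ 0 (by simp))
  have hcont : ContinuousOn (fun x => ‖f x + h x‖) (Icc 0 1) := fun x hx =>
    ((hf x hx).continuousWithinAt.add (hh x hx).continuousWithinAt).norm
  -- The maximum `M` of `|f + h|` bounds both perturbation terms; `M` is then estimated at its own
  -- maximum point, where `(1 + C) ε ≤ 1/2` lets it be absorbed.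
  obtain ⟨y, hy, hmax⟩ := isCompact_Icc.exists_isMaxOn ⟨0, by simp⟩ hcont
  set M := ‖f y + h y‖ with hM
  have hMax : ∀ x ∈ Icc (0 : ℝ) 1, ‖f x + h x‖ ≤ M := fun x hx => hmax hx
  have hM0 : 0 ≤ M := norm_nonneg _
  have key1 : ∀ x ∈ Icc (0 : ℝ) 1, ‖f x - f 0‖ ≤ ε * M := by
    intro x hx
    have := (convex_Icc (0 : ℝ) 1).norm_image_sub_le_of_norm_hasDerivWithin_le hf
      (C := ε * M) (fun t ht => by
        rw [norm_mul]
        exact mul_le_mul (hr₁ t ht) (hMax t ht) (norm_nonneg _) hε0)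
      (show (0 : ℝ) ∈ Icc (0 : ℝ) 1 by simp) hx
    refine this.trans (mul_le_of_le_one_right (by positivity) ?_)
    rw [sub_zero, Real.norm_of_nonneg hx.1]; exact hx.2
  -- Variation of constants: the factor `exp (T t - T x)` removes the term `-τ h`, and it is bounded
  -- by `C` because only `t ≤ x` occurs.
  have key2 : ∀ x ∈ Icc (0 : ℝ) 1, ‖h x - Complex.exp (-T x) * h 0‖ ≤ C * (ε * M) := by
    intro x hx
    have hsub : Icc 0 x ⊆ Icc (0 : ℝ) 1 := Icc_subset_Icc_right hx.2
    have := (convex_Icc (0 : ℝ) x).norm_image_sub_le_of_norm_hasDerivWithin_le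
      (f := fun t => Complex.exp (T t - T x) * h t)
      (f' := fun t => Complex.exp (T t - T x) * (r₂ t * (f t + h t)))
      (C := C * (ε * M)) (fun t ht => by
        have h1 := (((hT t (hsub ht)).sub_const (T x)).cexp).mul (hh t (hsub ht))
        refine (h1.congr_deriv ?_).mono hsub
        ring)
      (fun t ht => by
        rw [norm_mul, norm_mul]
        have h1 := hexp t x ht.1 ht.2 hx.2
        have h2 := hr₂ t (hsub ht)
        have h3 := hMax t (hsub ht)
        gcongr)
      (show (0 : ℝ) ∈ Icc (0 : ℝ) x from ⟨le_rfl, hx.1⟩) (show x ∈ Icc (0 : ℝ) x from ⟨hx.1, le_rfl⟩)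
    simp only [sub_self, Complex.exp_zero, one_mul, hT0, zero_sub, sub_zero] at this
    refine this.trans (mul_le_of_le_one_right (by positivity) ?_)
    rw [Real.norm_of_nonneg hx.1]; exact hx.2
  have hbound : ∀ x ∈ Icc (0 : ℝ) 1,
      ‖f x + h x - (f 0 + Complex.exp (-T x) * h 0)‖ ≤ (1 + C) * ε * M := by
    intro x hx
    calc _ = ‖(f x - f 0) + (h x - Complex.exp (-T x) * h 0)‖ := by congr 1; ring
      _ ≤ ε * M + C * (ε * M) := (norm_add_le _ _).trans (add_le_add (key1 x hx) (key2 x hx))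
      _ = _ := by ring
  have hM' : M ≤ 2 * (1 + C) := by
    have h1 := hbound y hy
    have h2 : ‖f 0 + Complex.exp (-T y) * h 0‖ ≤ 1 + C := by
      refine (norm_add_le _ _).trans (add_le_add hf0 ?_)
      rw [norm_mul]
      have := hexp 0 y le_rfl hy.1 hy.2
      rw [hT0, zero_sub] at this
      calc _ ≤ C * 1 := mul_le_mul this hh0 (norm_nonneg _) hC
        _ = C := mul_one _
    have h3 : M ≤ ‖f y + h y - (f 0 + Complex.exp (-T y) * h 0)‖ +
        ‖f 0 + Complex.exp (-T y) * h 0‖ := norm_le_norm_sub_add _ _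
    have h4 : (1 + C) * ε * M ≤ 1 / 2 * M := mul_le_mul_of_nonneg_right hε hM0
    linarith
  calc _ ≤ (1 + C) * ε * M := hbound 1 (by simp)
    _ ≤ (1 + C) * ε * (2 * (1 + C)) := by gcongr
    _ = _ := by ring

/-- In the variables `p = v + (z + M) u` and `q = (z + P) u - v` the system reads `p' = (z + M) p -
S u`, `q' = -(z + P) q + R u`, with `u = (p + q) / (2z + P + M)` and a denominator of modulus at
least `|z|`. Initially `p = 1` and `q = -1`, so without the residuals `p(1) + q(1) = exp (z + ∫ M) -
exp (-(z + ∫ P))`. Multiplication by `exp (z + ∫ P)` gives the main term. -/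
theorem norm_charFun_sub_le {a b : ℝ → ℝ} (ha : ContinuousOn a (Icc 0 1))
    (hb : ContinuousOn b (Icc 0 1)) {z : ℂ} (hz : z ≠ 0) {P P' R M M' S : ℝ → ℂ} {B ε : ℝ}
    (hP : ∀ x ∈ Icc (0 : ℝ) 1, HasDerivWithinAt P (P' x) (Icc 0 1) x)
    (hM : ∀ x ∈ Icc (0 : ℝ) 1, HasDerivWithinAt M (M' x) (Icc 0 1) x)
    (hPR : ∀ x ∈ Icc (0 : ℝ) 1, P' x + (z + P x) ^ 2 = z ^ 2 + 2 * z * a x - b x + R x)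
    (hMS : ∀ x ∈ Icc (0 : ℝ) 1, -M' x + (z + M x) ^ 2 = z ^ 2 + 2 * z * a x - b x + S x)
    (hPB : ∀ x ∈ Icc (0 : ℝ) 1, ‖P x‖ ≤ B) (hMB : ∀ x ∈ Icc (0 : ℝ) 1, ‖M x‖ ≤ B)
    (hzB : 2 * B ≤ ‖z‖)
    (hR : ∀ x ∈ Icc (0 : ℝ) 1, ‖R x‖ ≤ ε * ‖z‖) (hS : ∀ x ∈ Icc (0 : ℝ) 1, ‖S x‖ ≤ ε * ‖z‖)
    (hε : (1 + Real.exp (2 * B)) * ε ≤ 1 / 2) :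
    ‖Complex.exp (z + ∫ x in (0 : ℝ)..1, P x) * (2 * z + P 1 + M 1) * charFun a b z -
      (Complex.exp (2 * z + (∫ x in (0 : ℝ)..1, P x) + ∫ x in (0 : ℝ)..1, M x) - 1)‖ ≤
      2 * (1 + Real.exp (2 * B)) ^ 2 * ε * max 1
        ‖Complex.exp (2 * z + (∫ x in (0 : ℝ)..1, P x) + ∫ x in (0 : ℝ)..1, M x)‖ := by
  obtain ⟨u, v, huv, hu0, hv0, -⟩ := exists_isSolution ha hb z
  rw [charFun_eq ha hb huv hu0 hv0]
  obtain ⟨gP, hgP0, hgP1, hgP⟩ := exists_primitive fun x hx => (hP x hx).continuousWithinAt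
  obtain ⟨gM, hgM0, hgM1, hgM⟩ := exists_primitive fun x hx => (hM x hx).continuousWithinAt
  rw [← hgP1, ← hgM1]
  have hz0 : 0 < ‖z‖ := norm_pos_iff.2 hz
  have hB0 : 0 ≤ B := (norm_nonneg _).trans (hPB 0 (by simp))
  have hε0 : 0 ≤ ε := by
    have := (norm_nonneg _).trans (hR 0 (by simp))
    exact nonneg_of_mul_nonneg_left this hz0
  -- the sum of the two exponents
  have hσ : ∀ x ∈ Icc (0 : ℝ) 1, ‖z‖ ≤ ‖2 * z + P x + M x‖ := by
    intro x hx
    have h1 : ‖2 * z‖ ≤ ‖2 * z + P x + M x‖ + ‖P x + M x‖ := by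
      rw [show 2 * z + P x + M x = 2 * z + (P x + M x) by ring]
      have := norm_sub_le (2 * z + (P x + M x)) (P x + M x)
      rwa [add_sub_cancel_right] at this
    have h2 := norm_add_le (P x) (M x)
    have h3 := hPB x hx
    have h4 := hMB x hx
    rw [norm_mul, Complex.norm_ofNat] at h1
    linarith
  have hσ0 : ∀ x ∈ Icc (0 : ℝ) 1, 2 * z + P x + M x ≠ 0 := fun x hx =>
    norm_pos_iff.1 (hz0.trans_le (hσ x hx))
  have hdiv : ∀ {W : ℝ → ℂ}, (∀ x ∈ Icc (0 : ℝ) 1, ‖W x‖ ≤ ε * ‖z‖) →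
      ∀ x ∈ Icc (0 : ℝ) 1, ‖W x / (2 * z + P x + M x)‖ ≤ ε := by
    intro W hW x hx
    rw [norm_div, div_le_iff₀ (hz0.trans_le (hσ x hx))]
    exact (hW x hx).trans (mul_le_mul_of_nonneg_left (hσ x hx) hε0)
  -- the diagonalizing variables
  have hp : ∀ x ∈ Icc (0 : ℝ) 1, HasDerivWithinAt (fun x => v x + (z + M x) * u x)
      ((z + M x) * (v x + (z + M x) * u x) - S x * u x) (Icc 0 1) x := by
    intro x hx
    refine ((huv x hx).2.add (((hM x hx).const_add z).mul (huv x hx).1)).congr_deriv ?_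
    linear_combination (-u x) * hMS x hx
  have hq : ∀ x ∈ Icc (0 : ℝ) 1, HasDerivWithinAt (fun x => (z + P x) * u x - v x)
      (-(z + P x) * ((z + P x) * u x - v x) + R x * u x) (Icc 0 1) x := by
    intro x hx
    refine ((((hP x hx).const_add z).mul (huv x hx).1).sub (huv x hx).2).congr_deriv ?_
    linear_combination (u x) * hPR x hx
  have hA : ∀ x ∈ Icc (0 : ℝ) 1,
      HasDerivWithinAt (fun x : ℝ => z * x + gP x) (z + P x) (Icc 0 1) x := by
    intro x hx
    have := ((hasDerivAt_id x).ofReal_comp.const_mul z).hasDerivWithinAt (s := Icc 0 1)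
    refine (this.add (hgP x hx)).congr_deriv ?_
    simp
  have hB : ∀ x ∈ Icc (0 : ℝ) 1,
      HasDerivWithinAt (fun x : ℝ => z * x + gM x) (z + M x) (Icc 0 1) x := by
    intro x hx
    have := ((hasDerivAt_id x).ofReal_comp.const_mul z).hasDerivWithinAt (s := Icc 0 1)
    refine (this.add (hgM x hx)).congr_deriv ?_
    simp
  have hg : ∀ t x, 0 ≤ t → t ≤ x → x ≤ 1 → ‖(gP t - gP x) + (gM t - gM x)‖ ≤ 2 * B := by
    intro t x ht htx hx
    have aux : ∀ {W g : ℝ → ℂ}, (∀ x ∈ Icc (0 : ℝ) 1, HasDerivWithinAt g (W x) (Icc 0 1) x) →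
        (∀ x ∈ Icc (0 : ℝ) 1, ‖W x‖ ≤ B) → ‖g t - g x‖ ≤ B := by
      intro W g h1 h2
      have := (convex_Icc (0 : ℝ) 1).norm_image_sub_le_of_norm_hasDerivWithin_le h1 h2
        (show x ∈ Icc (0 : ℝ) 1 from ⟨ht.trans htx, hx⟩) (show t ∈ Icc (0 : ℝ) 1 from
          ⟨ht, htx.trans hx⟩)
      refine this.trans (mul_le_of_le_one_right hB0 ?_)
      rw [Real.norm_eq_abs, abs_le]; constructor <;> linarith
    calc _ ≤ B + B := (norm_add_le _ _).trans (add_le_add (aux hgP hPB) (aux hgM hMB))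
      _ = _ := by ring
  have hexp0 : 0 ≤ Real.exp (2 * B) := (Real.exp_pos _).le
  have hre : ∀ {w : ℂ}, ‖w‖ ≤ 2 * B → -(2 * B) ≤ w.re ∧ w.re ≤ 2 * B := fun hw =>
    abs_le.1 ((Complex.abs_re_le_norm _).trans hw)
  have hσu : ∀ x ∈ Icc (0 : ℝ) 1, u x =
      ((v x + (z + M x) * u x) + ((z + P x) * u x - v x)) / (2 * z + P x + M x) := by
    intro x hx
    rw [eq_div_iff (hσ0 x hx)]; ring
  have hKε : 0 ≤ 2 * (1 + Real.exp (2 * B)) ^ 2 * ε := by positivity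
  -- Both variables are rescaled by the inverse of the mode favoured by the sign of `Re z`: `p` for
  -- `Re z ≥ 0`, `q` for `Re z ≤ 0`. The other one then has a propagator bounded by `exp (2B)`.
  -- Undoing the two scalings yields the two entries of the maximum in the error.
  rcases le_total 0 z.re with hre0 | hre0
  · have key := norm_sub_le_of_perturbed_system (C := Real.exp (2 * B)) (ε := ε)
      (f := fun x => Complex.exp (-(z * x + gM x)) * (v x + (z + M x) * u x))
      (h := fun x => Complex.exp (-(z * x + gM x)) * ((z + P x) * u x - v x))
      (τ := fun x => 2 * z + P x + M x) (T := fun x => (z * x + gP x) + (z * x + gM x))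
      (r₁ := fun x => -(S x / (2 * z + P x + M x))) (r₂ := fun x => R x / (2 * z + P x + M x))
      hexp0
      (fun x hx => by
        refine (((hB x hx).fun_neg.cexp).mul (hp x hx)).congr_deriv ?_
        have h1 := hσu x hx
        have h2 := hσ0 x hx
        rw [← mul_add, neg_mul, div_mul_eq_mul_div, mul_left_comm, mul_div_assoc, mul_div_assoc,
          ← h1]
        ring)
      (fun x hx => by
        refine (((hB x hx).fun_neg.cexp).mul (hq x hx)).congr_deriv ?_
        have h1 := hσu x hx
        have h2 := hσ0 x hx
        rw [← mul_add, div_mul_eq_mul_div, mul_left_comm, mul_div_assoc, mul_div_assoc, ← h1]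
        ring)
      (fun x hx => ((hA x hx).add (hB x hx)).congr_deriv (by ring))
      (by simp [hgP0, hgM0]) (by simp [hgM0, hu0, hv0]) (by simp [hgM0, hu0, hv0])
      (fun x hx => by rw [norm_neg]; exact hdiv hS x hx) (hdiv hR)
      (fun t x ht htx hx => by
        rw [Complex.norm_exp, Real.exp_le_exp]
        have h1 := (hre (hg t x ht htx hx)).2
        have h2 : z.re * (t - x) ≤ 0 := mul_nonpos_of_nonneg_of_nonpos hre0 (by linarith)
        have h3 : (z * t + gP t + (z * t + gM t) - (z * x + gP x + (z * x + gM x))).re =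
            2 * (z.re * (t - x)) + ((gP t - gP x) + (gM t - gM x)).re := by
          simp; ring
        linarith) hε
    have he : Complex.exp (z + gP 1) * (2 * z + P 1 + M 1) * u 1 -
        (Complex.exp (2 * z + gP 1 + gM 1) - 1) = Complex.exp (2 * z + gP 1 + gM 1) *
        (Complex.exp (-(z * (1 : ℝ) + gM 1)) * (v 1 + (z + M 1) * u 1) +
          Complex.exp (-(z * (1 : ℝ) + gM 1)) * ((z + P 1) * u 1 - v 1) -
          (Complex.exp (-(z * (0 : ℝ) + gM 0)) * (v 0 + (z + M 0) * u 0) +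
          Complex.exp (-((z * (1 : ℝ) + gP 1) + (z * (1 : ℝ) + gM 1))) *
            (Complex.exp (-(z * (0 : ℝ) + gM 0)) * ((z + P 0) * u 0 - v 0)))) := by
      have e1 : Complex.exp (z + gP 1) = Complex.exp (2 * z + gP 1 + gM 1) *
          Complex.exp (-(z * (1 : ℝ) + gM 1)) := by
        rw [← Complex.exp_add]; congr 1; push_cast; ring
      have e2 : Complex.exp (2 * z + gP 1 + gM 1) *
          Complex.exp (-((z * (1 : ℝ) + gP 1) + (z * (1 : ℝ) + gM 1))) = 1 := by
        rw [← Complex.exp_add, ← Complex.exp_zero]; congr 1; push_cast; ring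
      have e3 : Complex.exp (-(z * (0 : ℝ) + gM 0)) = 1 := by simp [hgM0]
      rw [e1, e3, hu0, hv0]
      linear_combination -e2
    rw [he, norm_mul, mul_comm]
    exact mul_le_mul key (le_max_right _ _) (norm_nonneg _) hKε
  · have key := norm_sub_le_of_perturbed_system (C := Real.exp (2 * B)) (ε := ε)
      (f := fun x => Complex.exp (z * x + gP x) * ((z + P x) * u x - v x))
      (h := fun x => Complex.exp (z * x + gP x) * (v x + (z + M x) * u x))
      (τ := fun x => -(2 * z + P x + M x)) (T := fun x => -((z * x + gP x) + (z * x + gM x)))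
      (r₁ := fun x => R x / (2 * z + P x + M x)) (r₂ := fun x => -(S x / (2 * z + P x + M x)))
      hexp0
      (fun x hx => by
        refine (((hA x hx).cexp).mul (hq x hx)).congr_deriv ?_
        have h1 := hσu x hx
        have h2 := hσ0 x hx
        rw [← mul_add, add_comm ((z + P x) * u x - v x), div_mul_eq_mul_div, mul_left_comm,
          mul_div_assoc, mul_div_assoc, ← h1]
        ring)
      (fun x hx => by
        refine (((hA x hx).cexp).mul (hp x hx)).congr_deriv ?_
        have h1 := hσu x hx
        have h2 := hσ0 x hx
        rw [← mul_add, add_comm ((z + P x) * u x - v x), neg_mul (S x / _), div_mul_eq_mul_div,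
          mul_left_comm (S x), mul_div_assoc, mul_div_assoc, ← h1]
        ring)
      (fun x hx => ((hA x hx).add (hB x hx)).neg.congr_deriv (by ring))
      (by simp [hgP0, hgM0]) (by simp [hgP0, hu0, hv0]) (by simp [hgP0, hu0, hv0])
      (hdiv hR) (fun x hx => by rw [norm_neg]; exact hdiv hS x hx)
      (fun t x ht htx hx => by
        rw [Complex.norm_exp, Real.exp_le_exp]
        have h1 := (hre (hg t x ht htx hx)).1
        have h2 : 0 ≤ z.re * (t - x) := mul_nonneg_of_nonpos_of_nonpos hre0 (by linarith)
        have h3 : (-(z * t + gP t + (z * t + gM t)) - -(z * x + gP x + (z * x + gM x))).re =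
            -(2 * (z.re * (t - x)) + ((gP t - gP x) + (gM t - gM x)).re) := by
          simp; ring
        linarith) hε
    have he : Complex.exp (z + gP 1) * (2 * z + P 1 + M 1) * u 1 -
        (Complex.exp (2 * z + gP 1 + gM 1) - 1) =
        Complex.exp (z * (1 : ℝ) + gP 1) * ((z + P 1) * u 1 - v 1) +
          Complex.exp (z * (1 : ℝ) + gP 1) * (v 1 + (z + M 1) * u 1) -
          (Complex.exp (z * (0 : ℝ) + gP 0) * ((z + P 0) * u 0 - v 0) +
          Complex.exp (- -((z * (1 : ℝ) + gP 1) + (z * (1 : ℝ) + gM 1))) *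
            (Complex.exp (z * (0 : ℝ) + gP 0) * (v 0 + (z + M 0) * u 0))) := by
      have e1 : Complex.exp (z * (1 : ℝ) + gP 1) = Complex.exp (z + gP 1) := by simp
      have e2 : Complex.exp (- -((z * (1 : ℝ) + gP 1) + (z * (1 : ℝ) + gM 1))) =
          Complex.exp (2 * z + gP 1 + gM 1) := by
        congr 1; push_cast; ring
      have e3 : Complex.exp (z * (0 : ℝ) + gP 0) = 1 := by simp [hgP0]
      rw [e1, e2, e3, hu0, hv0]
      ring
    rw [he]
    refine key.trans ?_
    calc _ = 2 * (1 + Real.exp (2 * B)) ^ 2 * ε * 1 := (mul_one _).symm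
      _ ≤ _ := mul_le_mul_of_nonneg_left (le_max_left _ _) hKε

/-- `∑_{i<m} ⟨φ_i⟩ X^i`. -/
noncomputable def wkbMean (s : ℝ) (a b : ℝ → ℝ) (m : ℕ) (X : ℂ) : ℂ :=
  ∑ i ∈ Finset.range m, (mean (phi s a b i) : ℂ) * X ^ i

/-- The phase `2 (z + ∑_{i<m} g_i z^{-i})`. -/
noncomputable def phase (a b : ℝ → ℝ) (m : ℕ) (z : ℂ) : ℂ :=
  2 * (z + ∑ i ∈ Finset.range m, (g a b i : ℂ) * z⁻¹ ^ i)

theorem integral_wkb {s : ℝ} {a b : ℝ → ℝ} {m : ℕ}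
    (h : ∀ i < m, ContinuousOn (phi s a b i) (Icc 0 1)) (X : ℂ) :
    ∫ x in (0 : ℝ)..1, wkb s a b m X x = wkbMean s a b m X := by
  unfold wkb wkbMean
  rw [intervalIntegral.integral_finsetSum]
  · refine Finset.sum_congr rfl fun i _ => ?_
    rw [intervalIntegral.integral_mul_const, mean, intervalIntegral.integral_ofReal]
  · intro i hi
    refine ContinuousOn.intervalIntegrable ?_
    rw [uIcc_of_le zero_le_one]
    exact (Complex.continuous_ofReal.comp_continuousOn
      (h i (Finset.mem_range.1 hi))).mul continuousOn_const

theorem wkbMean_add_wkbMean {a b : ℝ → ℝ} {m : ℕ}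
    (h : ∀ s, ∀ i < m, ContinuousOn (phi s a b i) (Icc 0 1)) (z : ℂ) :
    2 * z + wkbMean 1 a b m z⁻¹ + wkbMean (-1) a b m z⁻¹ = phase a b m z := by
  unfold wkbMean phase
  rw [add_assoc, ← Finset.sum_add_distrib, mul_add, Finset.mul_sum]
  congr 1
  refine Finset.sum_congr rfl fun i hi => ?_
  have hi' := Finset.mem_range.1 hi
  have h1 : ∀ s, IntervalIntegrable (phi s a b i) MeasureTheory.volume 0 1 := fun s => by
    refine ContinuousOn.intervalIntegrable ?_
    rw [uIcc_of_le zero_le_one]; exact h s i hi'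
  have : 2 * g a b i = mean (phi 1 a b i) + mean (phi (-1) a b i) := by
    rw [g, mean, intervalIntegral.integral_add (h1 1) (h1 (-1))]
    simp only [mean]; ring
  have h2 := congrArg Complex.ofReal this
  push_cast at h2
  rw [← add_mul, ← mul_assoc, h2]

/-- The Riccati residual is `O(|z|^{1-m})`, and division by the sum of the exponents gains the last
power of `z`. -/
theorem charFun_asymptotics {m : ℕ} (hm : 1 ≤ m) {a b : ℝ → ℝ}
    (ha : ContDiffOn ℝ ((m + 1 : ℕ) : ℕ∞) a (Icc (0 : ℝ) 1))
    (hb : ContDiffOn ℝ (m : ℕ∞) b (Icc (0 : ℝ) 1)) :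
    ∃ C R₀ : ℝ, 0 ≤ C ∧ 1 ≤ R₀ ∧ ∀ z : ℂ, R₀ ≤ ‖z‖ →
      2 * z + wkb 1 a b m z⁻¹ 1 + wkb (-1) a b m z⁻¹ 1 ≠ 0 ∧
      ‖Complex.exp (z + wkbMean 1 a b m z⁻¹) *
          (2 * z + wkb 1 a b m z⁻¹ 1 + wkb (-1) a b m z⁻¹ 1) * charFun a b z -
        (Complex.exp (phase a b m z) - 1)‖ ≤
      C * ‖z‖⁻¹ ^ m * max 1 ‖Complex.exp (phase a b m z)‖ := by
  obtain ⟨k, rfl⟩ : ∃ k, m = k + 1 := ⟨m - 1, by omega⟩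
  have hphi : ∀ (s : ℝ), ∀ i < k + 1, ContDiffOn ℝ ((1 + 1 : ℕ) : ℕ∞) (phi s a b i) (Icc 0 1) :=
    fun s i hi => (contDiffOn_phi ha hb s i (k + 1 + 1 - i) (by omega)).of_le
      (by norm_cast; omega)
  have hcont : ∀ (s : ℝ), ∀ i < k + 1, ContinuousOn (phi s a b i) (Icc 0 1) :=
    fun s i hi => (hphi s i hi).continuousOn
  have hderiv : ∀ (s : ℝ), ∀ i < k + 1, ∀ x ∈ Icc (0 : ℝ) 1,
      HasDerivWithinAt (phi s a b i) (D (phi s a b i) x) (Icc 0 1) x :=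
    fun s i hi x hx => hasDerivWithinAt_D (hphi s i hi) hx
  have hres : ∀ s : ℝ, ∃ B, ∀ z : ℂ, 1 ≤ ‖z‖ → ∀ x ∈ Icc (0 : ℝ) 1,
      ‖wkbResidual s a b k z⁻¹ x‖ ≤ B := fun s =>
    exists_norm_le_of_continuousOn (continuousOn_wkbResidual (hcont s)
      (contDiffOn_D (hphi s k (by omega))).continuousOn hb.continuousOn _)
  have hwkb : ∀ s : ℝ, ∃ B, ∀ z : ℂ, 1 ≤ ‖z‖ → ∀ x ∈ Icc (0 : ℝ) 1,
      ‖wkb s a b (k + 1) z⁻¹ x‖ ≤ B := fun s =>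
    exists_norm_le_of_continuousOn (continuousOn_wkb (hcont s) _)
  obtain ⟨r₁, hr₁⟩ := hres 1
  obtain ⟨r₂, hr₂⟩ := hres (-1)
  obtain ⟨B₁, hB₁⟩ := hwkb 1
  obtain ⟨B₂, hB₂⟩ := hwkb (-1)
  set r := max r₁ r₂ with hr
  set B := max B₁ B₂ with hB
  have hr0 : 0 ≤ r := (norm_nonneg _).trans ((hr₁ 1 (by simp) 0 (by simp)).trans (le_max_left _ _))
  set K := 1 + Real.exp (2 * B) with hK
  have hK0 : 0 < K := by positivity
  -- The bound `2B + 1` keeps the prefactor away from `0`; `2Kr` gives the smallness `K ε ≤ 1/2`;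
  -- `1` puts `z⁻¹` in the unit disc.
  refine ⟨2 * K ^ 2 * r, max 1 (max (2 * B + 1) (2 * K * r)), by positivity, le_max_left _ _, ?_⟩
  intro z hz
  obtain ⟨hz1, hz2, hz3⟩ : 1 ≤ ‖z‖ ∧ 2 * B + 1 ≤ ‖z‖ ∧ 2 * K * r ≤ ‖z‖ := by
    simpa only [max_le_iff] using hz
  have hz0 : z ≠ 0 := norm_pos_iff.1 (by linarith)
  have hzpos : 0 < ‖z‖ := by linarith
  have hP1 := fun x hx => (hB₁ z hz1 x hx).trans (le_max_left B₁ B₂)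
  have hP2 := fun x hx => (hB₂ z hz1 x hx).trans (le_max_right B₁ B₂)
  constructor
  · intro h0
    have h1 : 2 * z = -(wkb 1 a b (k + 1) z⁻¹ 1 + wkb (-1) a b (k + 1) z⁻¹ 1) := by
      linear_combination h0
    have h2 := norm_add_le (wkb 1 a b (k + 1) z⁻¹ 1) (wkb (-1) a b (k + 1) z⁻¹ 1)
    rw [← norm_neg (_ + _), ← h1, norm_mul, Complex.norm_ofNat] at h2
    have h3 := hP1 1 (by simp)
    have h4 := hP2 1 (by simp)
    linarith
  · have hεz : ∀ {w : ℂ}, ‖w‖ ≤ r → ‖z⁻¹ ^ k * w‖ ≤ r * ‖z‖⁻¹ ^ (k + 1) * ‖z‖ := by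
      intro w hw
      rw [norm_mul, norm_pow, norm_inv, pow_succ]
      calc _ ≤ ‖z‖⁻¹ ^ k * r := by gcongr
        _ = r * (‖z‖⁻¹ ^ k * ‖z‖⁻¹) * ‖z‖ := by field_simp
    have key := norm_charFun_sub_le ha.continuousOn hb.continuousOn hz0
      (P := wkb 1 a b (k + 1) z⁻¹) (P' := wkbDeriv 1 a b (k + 1) z⁻¹)
      (R := fun x => z⁻¹ ^ k * wkbResidual 1 a b k z⁻¹ x)
      (M := wkb (-1) a b (k + 1) z⁻¹) (M' := wkbDeriv (-1) a b (k + 1) z⁻¹)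
      (S := fun x => z⁻¹ ^ k * wkbResidual (-1) a b k z⁻¹ x) (B := B)
      (ε := r * ‖z‖⁻¹ ^ (k + 1))
      (fun x hx => hasDerivWithinAt_wkb (hderiv 1) z⁻¹ hx)
      (fun x hx => hasDerivWithinAt_wkb (hderiv (-1)) z⁻¹ hx)
      (fun x _ => by simpa using riccati_wkb 1 a b k hz0 x)
      (fun x _ => by simpa using riccati_wkb (-1) a b k hz0 x)
      hP1 hP2 (by linarith)
      (fun x hx => hεz ((hr₁ z hz1 x hx).trans (le_max_left _ _)))
      (fun x hx => hεz ((hr₂ z hz1 x hx).trans (le_max_right _ _)))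
      (by
        have h1 : ‖z‖⁻¹ ^ (k + 1) ≤ ‖z‖⁻¹ :=
          pow_le_of_le_one (by positivity) (inv_le_one_of_one_le₀ hz1) (by omega)
        calc K * (r * ‖z‖⁻¹ ^ (k + 1)) ≤ K * (r * ‖z‖⁻¹) := by gcongr
          _ = K * r / ‖z‖ := by field_simp
          _ ≤ 1 / 2 := by rw [div_le_iff₀ hzpos]; linarith)
    rw [integral_wkb (hcont 1), integral_wkb (hcont (-1)), wkbMean_add_wkbMean hcont] at key
    refine key.trans (le_of_eq ?_)
    ring

/-! ### Counting and localization of the eigenvalues -/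

/-- The radius passes midway between the zeros `π k i` of `exp (2w) - 1`. If `|Re w| ≥ 1`, the
exponential is large or small. Otherwise `w` is close to `±π (n + 1/2) i`, where `exp (2w)` has
nonpositive real part and modulus at most `exp 2 < 8`. -/
theorem max_one_norm_exp_le {n : ℕ} (hn : 1 ≤ n) {w : ℂ} (hw : ‖w‖ = Real.pi * (n + 1 / 2)) :
    max 1 ‖Complex.exp (2 * w)‖ ≤ 8 * ‖Complex.exp (2 * w) - 1‖ := by
  have hnorm : ‖Complex.exp (2 * w)‖ = Real.exp (2 * w.re) := by simp [Complex.norm_exp]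
  have he : (2 : ℝ) ≤ Real.exp 2 := by have := Real.add_one_le_exp (2 : ℝ); linarith
  rcases le_or_gt 1 |w.re| with hx | hx
  · rcases le_abs.1 hx with hx | hx
    · have h1 : 2 ≤ Real.exp (2 * w.re) := he.trans (Real.exp_le_exp.2 (by linarith))
      have h2 := norm_sub_norm_le (Complex.exp (2 * w)) 1
      rw [norm_one, hnorm] at h2
      rw [hnorm, max_eq_right (by linarith)]
      linarith
    · have h1 : Real.exp (2 * w.re) ≤ 1 / 2 := by
        have : Real.exp (2 * w.re) ≤ Real.exp (-2) := Real.exp_le_exp.2 (by linarith)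
        rw [Real.exp_neg] at this
        refine this.trans ?_
        rw [one_div]
        exact inv_anti₀ two_pos he
      have h2 := norm_sub_norm_le 1 (Complex.exp (2 * w))
      rw [norm_one, hnorm, norm_sub_rev] at h2
      rw [hnorm, max_eq_left (by linarith)]
      linarith
  · have hcos : Real.cos (2 * w.im) ≤ 0 := by
      have hn' : (1 : ℝ) ≤ n := by exact_mod_cast hn
      have hpi := Real.pi_gt_three
      have hR : 4 ≤ ‖w‖ := by rw [hw]; nlinarith
      have hy1 : |w.im| ≤ ‖w‖ := Complex.abs_im_le_norm w
      have hsq : ‖w‖ ^ 2 = |w.re| ^ 2 + |w.im| ^ 2 := by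
        rw [sq_abs, sq_abs, Complex.sq_norm, Complex.normSq_apply]; ring
      -- Here `(‖w‖ - |Im w|)(‖w‖ + |Im w|) = (Re w)² ≤ 1` and `‖w‖ ≥ 4`.
      have hy2 : ‖w‖ - |w.im| ≤ 1 / 4 := by
        have h1 : (‖w‖ - |w.im|) * (‖w‖ + |w.im|) ≤ 1 := by
          have : |w.re| ^ 2 ≤ 1 := pow_le_one₀ (abs_nonneg _) hx.le
          nlinarith
        have h2 : (‖w‖ - |w.im|) * 4 ≤ (‖w‖ - |w.im|) * (‖w‖ + |w.im|) :=
          mul_le_mul_of_nonneg_left (by linarith [abs_nonneg w.im]) (by linarith)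
        linarith
      have h3 : Real.cos (2 * w.im) = -Real.cos (2 * (‖w‖ - |w.im|)) := by
        have h4 : Real.cos (2 * w.im) = Real.cos (2 * |w.im|) := by
          rw [← Real.cos_abs, abs_mul, abs_two]
        rw [h4, ← Real.cos_neg (2 * (‖w‖ - |w.im|)), ← Real.cos_add_pi,
          ← Real.cos_sub_nat_mul_two_pi _ n]
        congr 1
        rw [hw]; ring
      rw [h3, neg_nonpos]
      refine Real.cos_nonneg_of_neg_pi_div_two_le_of_le ?_ ?_ <;> linarith
    have h1 : 1 ≤ ‖Complex.exp (2 * w) - 1‖ := by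
      have h2 := (abs_le.1 (Complex.abs_re_le_norm (Complex.exp (2 * w) - 1))).1
      have h3 : (Complex.exp (2 * w) - 1).re = Real.exp (2 * w.re) * Real.cos (2 * w.im) - 1 := by
        rw [Complex.sub_re, Complex.exp_re]; simp
      have := mul_nonpos_of_nonneg_of_nonpos (Real.exp_pos (2 * w.re)).le hcos
      linarith
    have h2 : Real.exp (2 * w.re) ≤ 8 := by
      have h3 : Real.exp (2 * w.re) ≤ Real.exp 2 :=
        Real.exp_le_exp.2 (by linarith [(abs_lt.1 hx).2])
      have h4 : Real.exp 2 = Real.exp 1 ^ 2 := by rw [← Real.exp_nat_mul]; norm_num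
      have h5 := Real.exp_one_lt_d9
      have h6 := Real.exp_pos 1
      nlinarith
    rw [hnorm]
    exact max_le (by linarith) (by linarith)

theorem exp_two_mul_add_sub_one_eq_zero_iff (c z : ℂ) :
    Complex.exp (2 * (z + c)) - 1 = 0 ↔ ∃ k : ℤ, z = -c + Real.pi * k * Complex.I := by
  rw [sub_eq_zero, Complex.exp_eq_one_iff]
  refine exists_congr fun k => ⟨fun h => ?_, fun h => ?_⟩
  · linear_combination h / 2
  · rw [h]; ring

theorem norm_pi_mul_int_mul_I (k : ℤ) : ‖(Real.pi * k * Complex.I : ℂ)‖ = Real.pi * |(k : ℝ)| := by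
  simp [abs_of_pos Real.pi_pos]

theorem sum_analyticOrderNatAt_exp (c : ℂ) (n : ℕ) {Z : Finset ℂ}
    (hZ : ∀ z, z ∈ Z ↔ z ∈ Metric.ball (-c) (Real.pi * (n + 1 / 2)) ∧
      Complex.exp (2 * (z + c)) - 1 = 0) :
    ∑ w ∈ Z, analyticOrderNatAt (fun z => Complex.exp (2 * (z + c)) - 1) w = 2 * n + 1 := by
  have hord : ∀ w ∈ Z, analyticOrderNatAt (fun z => Complex.exp (2 * (z + c)) - 1) w = 1 := by
    intro w hw
    have hd : HasDerivAt (fun z => Complex.exp (2 * (z + c)) - 1)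
        (Complex.exp (2 * (w + c)) * (2 * 1)) w :=
      ((((hasDerivAt_id w).add_const c).const_mul 2).cexp).sub_const 1
    have h1 : analyticOrderAt (fun z => Complex.exp (2 * (z + c)) - 1) w = 1 := by
      refine AnalyticAt.analyticOrderAt_eq_one_of_zero_deriv_ne_zero (by fun_prop)
        ((hZ w).1 hw).2 ?_
      rw [hd.deriv]
      simp [Complex.exp_ne_zero]
    simp [analyticOrderNatAt, h1]
  rw [Finset.sum_congr rfl hord, Finset.sum_const, smul_eq_mul, mul_one]
  have himg : Z = (Finset.Icc (-n : ℤ) n).image fun k : ℤ => -c + Real.pi * k * Complex.I := by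
    ext z
    rw [hZ, exp_two_mul_add_sub_one_eq_zero_iff, Finset.mem_image]
    have hk : ∀ k : ℤ, -c + Real.pi * k * Complex.I ∈ Metric.ball (-c) (Real.pi * (n + 1 / 2)) ↔
        k ∈ Finset.Icc (-n : ℤ) n := by
      intro k
      rw [mem_ball_iff_norm, add_sub_cancel_left, norm_pi_mul_int_mul_I,
        mul_lt_mul_iff_right₀ Real.pi_pos, Finset.mem_Icc, ← abs_le]
      constructor
      · intro h
        have : |k| < (n : ℤ) + 1 := by
          have : (|k| : ℝ) < n + 1 := by linarith
          exact_mod_cast this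
        omega
      · intro h
        have : (|k| : ℝ) ≤ n := by exact_mod_cast h
        linarith
    constructor
    · rintro ⟨h, k, rfl⟩
      exact ⟨k, (hk k).1 h, rfl⟩
    · rintro ⟨k, h, rfl⟩
      exact ⟨(hk k).2 h, k, rfl⟩
  rw [himg, Finset.card_image_of_injective, Int.card_Icc]
  · omega
  · intro k l h
    have h1 : (Real.pi * Complex.I : ℂ) ≠ 0 :=
      mul_ne_zero (by exact_mod_cast Real.pi_ne_zero) Complex.I_ne_zero
    have h2 : (Real.pi * Complex.I : ℂ) * k = Real.pi * Complex.I * l := by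
      simp only at h; linear_combination h
    exact_mod_cast mul_left_cancel₀ h1 h2

theorem g_zero (a b : ℝ → ℝ) : g a b 0 = mean a := by
  have : (fun x => phi 1 a b 0 x + phi (-1) a b 0 x) = fun x => 2 * a x := by
    ext x; rw [phi, phi]; ring
  rw [g, this, mean, intervalIntegral.integral_const_mul, mean]; ring

/-- To first order both correction terms at `x = 1` are `a 1`, so the prefactor is entire with the
single zero `-a 1`, as Rouché's theorem requires. -/
theorem charFun_asymptotics_one {a b : ℝ → ℝ}
    (ha : ContDiffOn ℝ ((1 + 1 : ℕ) : ℕ∞) a (Icc (0 : ℝ) 1))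
    (hb : ContDiffOn ℝ ((1 : ℕ) : ℕ∞) b (Icc (0 : ℝ) 1)) :
    ∃ C R₀ : ℝ, 0 ≤ C ∧ 1 ≤ R₀ ∧ ∀ z : ℂ, R₀ ≤ ‖z‖ →
      ‖Complex.exp (z + mean a) * (2 * z + 2 * a 1) * charFun a b z -
        (Complex.exp (2 * (z + mean a)) - 1)‖ ≤
      C * ‖z‖⁻¹ * max 1 ‖Complex.exp (2 * (z + mean a))‖ := by
  obtain ⟨C, R₀, hC, hR₀, h⟩ := charFun_asymptotics le_rfl ha hb
  refine ⟨C, R₀, hC, hR₀, fun z hz => ?_⟩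
  have h1 : ∀ s X, wkbMean s a b 1 X = mean a := fun s X => by simp [wkbMean, phi]
  have h2 : ∀ s X, wkb s a b 1 X 1 = a 1 := fun s X => by simp [wkb, phi]
  have h3 : phase a b 1 z = 2 * (z + mean a) := by simp [phase, g_zero]
  have := (h z hz).2
  rw [h1, h2, h2, h3, pow_one] at this
  convert this using 4
  ring

/-- Rouché against `exp (2 (z + ⟨a⟩)) - 1`, which has `2n + 1` simple zeros in the disc. The
prefactor contributes one zero, at `-a 1`, leaving `2n` for the characteristic function. -/
theorem exists_sum_order_charFun_eq {a b : ℝ → ℝ}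
    (ha : ContDiffOn ℝ ((1 + 1 : ℕ) : ℕ∞) a (Icc (0 : ℝ) 1))
    (hb : ContDiffOn ℝ ((1 : ℕ) : ℕ∞) b (Icc (0 : ℝ) 1)) :
    (∃ p, charFun a b p ≠ 0) ∧ ∃ n₀ : ℕ, ∀ n ≥ n₀, ∀ Z : Finset ℂ,
      (∀ z, z ∈ Z ↔ z ∈ Metric.ball (-(mean a : ℂ)) (Real.pi * (n + 1 / 2)) ∧
        charFun a b z = 0) → ∑ w ∈ Z, analyticOrderNatAt (charFun a b) w = 2 * n := by
  obtain ⟨C, R₀, hC, hR₀, h⟩ := charFun_asymptotics_one ha hb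
  have hF := differentiable_charFun ha.continuousOn hb.continuousOn
  set F := charFun a b
  set c : ℂ := (mean a : ℂ) with hc
  obtain ⟨n₀, hn₀⟩ := exists_nat_gt (‖c‖ + R₀ + 8 * C + ‖(a 1 : ℂ)‖)
  have hn₀' : 1 ≤ n₀ := by
    have : (0 : ℝ) < n₀ := by
      have := norm_nonneg c; have := norm_nonneg (a 1 : ℂ); linarith
    exact_mod_cast this
  have hrouche : ∀ n ≥ n₀, ∀ z ∈ Metric.sphere (-c) (Real.pi * (n + 1 / 2)),
      ‖Complex.exp (z + c) * (2 * z + 2 * a 1) * F z - (Complex.exp (2 * (z + c)) - 1)‖ <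
        ‖Complex.exp (2 * (z + c)) - 1‖ := by
    intro n hn z hz
    have hn1 : (n₀ : ℝ) ≤ n := by exact_mod_cast hn
    have hw : ‖z + c‖ = Real.pi * (n + 1 / 2) := by
      rwa [mem_sphere_iff_norm, sub_neg_eq_add] at hz
    have hwn : (n : ℝ) ≤ ‖z + c‖ := by
      rw [hw]; have := Real.pi_gt_three
      have : (0 : ℝ) ≤ n := by positivity
      nlinarith
    have hzn : R₀ + 8 * C < ‖z‖ := by
      have := norm_add_le z c
      have := norm_nonneg (a 1 : ℂ)
      linarith
    have hmax := max_one_norm_exp_le (hn₀'.trans hn) hw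
    have hpos : 0 < ‖Complex.exp (2 * (z + c)) - 1‖ := by
      have : (1 : ℝ) ≤ max 1 ‖Complex.exp (2 * (z + c))‖ := le_max_left _ _
      linarith
    refine (h z (by linarith)).trans_lt ?_
    have hz0 : 0 < ‖z‖ := by linarith
    calc C * ‖z‖⁻¹ * max 1 ‖Complex.exp (2 * (z + c))‖
        ≤ C * ‖z‖⁻¹ * (8 * ‖Complex.exp (2 * (z + c)) - 1‖) := by gcongr
      _ = (8 * C / ‖z‖) * ‖Complex.exp (2 * (z + c)) - 1‖ := by field_simp
      _ < 1 * ‖Complex.exp (2 * (z + c)) - 1‖ := by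
        refine mul_lt_mul_of_pos_right ?_ hpos
        rw [div_lt_one hz0]; linarith
      _ = _ := one_mul _
  have hp : ∃ p, F p ≠ 0 := by
    have hr : 0 ≤ Real.pi * (n₀ + 1 / 2) := by positivity
    refine ⟨-c + (Real.pi * (n₀ + 1 / 2) : ℝ), fun h0 => ?_⟩
    have := hrouche n₀ le_rfl (-c + (Real.pi * (n₀ + 1 / 2) : ℝ)) (by
      rw [mem_sphere_iff_norm, add_sub_cancel_left, Complex.norm_real, Real.norm_of_nonneg hr])
    rw [h0, mul_zero, zero_sub, norm_neg] at this
    exact lt_irrefl _ this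
  refine ⟨hp, n₀, fun n hn Z hZ => ?_⟩
  obtain ⟨p, hp⟩ := hp
  have hR : 0 < Real.pi * (n + 1 / 2) := by have := Real.pi_pos; positivity
  have hG : Differentiable ℂ fun z => Complex.exp (2 * (z + c)) - 1 := by fun_prop
  have hL : Differentiable ℂ fun z : ℂ => Complex.exp (z + c) * (2 * z + 2 * a 1) := by fun_prop
  have hZg : {z | z ∈ Metric.ball (-c) (Real.pi * (n + 1 / 2)) ∧
      Complex.exp (2 * (z + c)) - 1 = 0}.Finite := by
    refine (finite_zeros_closedBall hG (p := 1 - c) ?_ (-c) (Real.pi * (n + 1 / 2))).subset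
      fun z hz => ⟨Metric.ball_subset_closedBall hz.1, hz.2⟩
    rw [sub_add_cancel, sub_ne_zero, Ne, Complex.ext_iff, not_and_or]
    left
    rw [Complex.exp_re]
    have : (2 : ℝ) < Real.exp 2 := by have := Real.add_one_lt_exp (two_ne_zero (α := ℝ)); linarith
    simp
  have hmem : -(a 1 : ℂ) ∈ Metric.ball (-c) (Real.pi * (n + 1 / 2)) := by
    rw [mem_ball_iff_norm]
    have h1 := norm_add_le (-(a 1 : ℂ)) c
    rw [norm_neg] at h1
    have hn1 : (n₀ : ℝ) ≤ n := by exact_mod_cast hn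
    have := Real.pi_gt_three
    have h0 : (0 : ℝ) ≤ n := by positivity
    rw [sub_neg_eq_add]
    nlinarith
  -- The point `-a 1` may itself be an eigenvalue and already lie in `Z`; orders add in either case.
  have key := rouche hR (f := fun z => Complex.exp (z + c) * (2 * z + 2 * a 1) * F z)
    (hL.mul hF) hG (hrouche n hn) (Zf := insert (-(a 1 : ℂ)) Z) (Zg := hZg.toFinset)
    (fun z => by
      rw [Finset.mem_insert, hZ, mul_eq_zero, mul_eq_zero]
      have h1 : 2 * z + 2 * (a 1 : ℂ) = 0 ↔ z = -(a 1 : ℂ) :=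
        ⟨fun h => by linear_combination h / 2, fun h => by rw [h]; ring⟩
      simp only [Complex.exp_ne_zero, false_or, h1]
      constructor
      · rintro (rfl | h)
        · exact ⟨hmem, Or.inl rfl⟩
        · exact ⟨h.1, Or.inr h.2⟩
      · rintro ⟨h, rfl | h'⟩
        · exact Or.inl rfl
        · exact Or.inr ⟨h, h'⟩)
    (fun z => by simp)
  rw [sum_analyticOrderNatAt_exp c n (fun z => by simp)] at key
  have hLord : ∀ w, analyticOrderNatAt (fun z : ℂ => Complex.exp (z + c) * (2 * z + 2 * a 1)) w =
      if w = -(a 1 : ℂ) then 1 else 0 := by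
    intro w
    split_ifs with hw
    · have hd : HasDerivAt (fun z : ℂ => Complex.exp (z + c) * (2 * z + 2 * a 1))
          (Complex.exp (w + c) * 1 * (2 * w + 2 * a 1) + Complex.exp (w + c) * (2 * 1)) w :=
        (((hasDerivAt_id w).add_const c).cexp).mul
          (((hasDerivAt_id w).const_mul 2).add_const (2 * (a 1 : ℂ)))
      have : analyticOrderAt (fun z : ℂ => Complex.exp (z + c) * (2 * z + 2 * a 1)) w = 1 := by
        refine AnalyticAt.analyticOrderAt_eq_one_of_zero_deriv_ne_zero (hL.analyticAt w) ?_ ?_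
        · rw [hw]; ring
        · rw [hd.deriv, hw]; simp [Complex.exp_ne_zero]
      simp [analyticOrderNatAt, this]
    · have : analyticOrderAt (fun z : ℂ => Complex.exp (z + c) * (2 * z + 2 * a 1)) w = 0 := by
        rw [(hL.analyticAt w).analyticOrderAt_eq_zero]
        refine mul_ne_zero (Complex.exp_ne_zero _) fun h => hw ?_
        linear_combination h / 2
      simp [analyticOrderNatAt, this]
  have hord : ∀ w, analyticOrderNatAt
      (fun z : ℂ => Complex.exp (z + c) * (2 * z + 2 * a 1) * F z) w =
      (if w = -(a 1 : ℂ) then 1 else 0) + analyticOrderNatAt F w := by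
    intro w
    rw [← hLord w]
    refine analyticOrderNatAt_mul (hL.analyticAt w) (hF.analyticAt w) ?_
      (analyticOrderAt_ne_top_of_entire hF hp w)
    refine analyticOrderAt_ne_top_of_entire hL (p := 1 - a 1) ?_ w
    refine mul_ne_zero (Complex.exp_ne_zero _) ?_
    ring_nf; norm_num
  rw [Finset.sum_congr rfl fun w _ => hord w, Finset.sum_add_distrib,
    Finset.sum_ite_eq' _ _ (fun _ => 1), if_pos (Finset.mem_insert_self _ _)] at key
  have hsum : ∑ w ∈ insert (-(a 1 : ℂ)) Z, analyticOrderNatAt F w =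
      ∑ w ∈ Z, analyticOrderNatAt F w := by
    refine (Finset.sum_subset (Finset.subset_insert _ _) fun w hw hwZ => ?_).symm
    have hwb : w ∈ Metric.ball (-c) (Real.pi * (n + 1 / 2)) := by
      rcases Finset.mem_insert.1 hw with rfl | hw
      · exact hmem
      · exact absurd hw hwZ
    by_contra h0
    exact hwZ ((hZ w).2 ⟨hwb, apply_eq_zero_of_analyticOrderNatAt_ne_zero h0⟩)
  rw [hsum] at key
  omega

/-- At a zero of the characteristic function the asymptotics force `exp (phase)` close to `1`, and
its logarithm measures the distance of the phase from `2 π i ℤ`. The second, cruder estimate serves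
to identify `k` from the imaginary part. -/
theorem exists_int_phase_close {m : ℕ} (hm : 1 ≤ m) {a b : ℝ → ℝ}
    (ha : ContDiffOn ℝ ((m + 1 : ℕ) : ℕ∞) a (Icc (0 : ℝ) 1))
    (hb : ContDiffOn ℝ (m : ℕ∞) b (Icc (0 : ℝ) 1)) :
    ∃ C R₀ : ℝ, 0 ≤ C ∧ 1 ≤ R₀ ∧ ∀ z : ℂ, R₀ ≤ ‖z‖ → charFun a b z = 0 → ∃ k : ℤ,
      ‖z + ∑ i ∈ Finset.range m, (g a b i : ℂ) * z⁻¹ ^ i - Real.pi * k * Complex.I‖ ≤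
        C * ‖z‖⁻¹ ^ m ∧
      ‖z + mean a - Real.pi * k * Complex.I‖ ≤ 1 := by
  obtain ⟨C, R₀, hC, hR₀, h⟩ := charFun_asymptotics hm ha hb
  obtain ⟨k, rfl⟩ : ∃ k, m = k + 1 := ⟨m - 1, by omega⟩
  set G := ∑ i ∈ Finset.range k, |g a b (i + 1)| with hG
  have hG0 : 0 ≤ G := Finset.sum_nonneg fun i _ => abs_nonneg _
  -- The term `4C` makes `δ ≤ 1/4`; `G + C` makes `δ` plus the terms `i ≥ 1` at most `1`.
  refine ⟨C, R₀ + 4 * C + G + C, hC, by linarith, fun z hz hz0 => ?_⟩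
  have hz1 : 1 ≤ ‖z‖ := by linarith
  have hzpos : 0 < ‖z‖ := by linarith
  have hinv : ‖z‖⁻¹ ^ (k + 1) ≤ ‖z‖⁻¹ :=
    pow_le_of_le_one (by positivity) (inv_le_one_of_one_le₀ hz1) (by omega)
  have h1 := (h z (by linarith)).2
  rw [hz0, mul_zero, zero_sub, norm_neg] at h1
  set δ := C * ‖z‖⁻¹ ^ (k + 1) with hδ
  set E := Complex.exp (phase a b (k + 1) z) with hE
  have hδ0 : 0 ≤ δ := by positivity
  have hδ' : δ ≤ C / ‖z‖ := by rw [div_eq_mul_inv]; exact mul_le_mul_of_nonneg_left hinv hC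
  have hδ4 : δ ≤ 1 / 4 := by
    refine hδ'.trans ?_
    rw [div_le_iff₀ hzpos]; linarith
  have hE1 : ‖E‖ ≤ 1 + ‖E - 1‖ := by
    have := norm_add_le (1 : ℂ) (E - 1)
    rwa [add_sub_cancel, norm_one] at this
  have hE2 : ‖E - 1‖ ≤ 4 / 3 * δ := by
    rcases le_total 1 ‖E‖ with h2 | h2
    · rw [max_eq_right h2] at h1
      have : δ * ‖E‖ ≤ 1 / 4 * ‖E‖ := mul_le_mul_of_nonneg_right hδ4 (norm_nonneg _)
      have : ‖E‖ ≤ 4 / 3 := by linarith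
      have := mul_le_mul_of_nonneg_left this hδ0
      linarith
    · rw [max_eq_left h2] at h1
      linarith
  have hlog : ‖Complex.log E‖ ≤ 2 * δ := by
    have h2 := Complex.norm_log_one_add_half_le_self (z := E - 1) (by linarith)
    rw [add_sub_cancel] at h2
    linarith
  have hexp : Complex.exp (phase a b (k + 1) z) = Complex.exp (Complex.log E) := by
    rw [Complex.exp_log (Complex.exp_ne_zero _)]
  obtain ⟨l, hl⟩ := Complex.exp_eq_exp_iff_exists_int.1 hexp
  have hmain : ‖z + ∑ i ∈ Finset.range (k + 1), (g a b i : ℂ) * z⁻¹ ^ i -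
      Real.pi * l * Complex.I‖ ≤ δ := by
    have h2 : z + ∑ i ∈ Finset.range (k + 1), (g a b i : ℂ) * z⁻¹ ^ i -
        Real.pi * l * Complex.I = Complex.log E / 2 := by
      rw [phase] at hl
      linear_combination hl / 2
    rw [h2, norm_div, Complex.norm_ofNat]
    linarith
  refine ⟨l, hmain, ?_⟩
  rw [Finset.sum_range_succ', g_zero, pow_zero, mul_one] at hmain
  have htail : ‖∑ i ∈ Finset.range k, (g a b (i + 1) : ℂ) * z⁻¹ ^ (i + 1)‖ ≤ G / ‖z‖ := by
    rw [hG, Finset.sum_div]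
    refine norm_sum_le_of_le _ fun i _ => ?_
    rw [norm_mul, norm_pow, norm_inv, Complex.norm_real, Real.norm_eq_abs, div_eq_mul_inv]
    exact mul_le_mul_of_nonneg_left
      (pow_le_of_le_one (by positivity) (inv_le_one_of_one_le₀ hz1) (by omega)) (abs_nonneg _)
  have h3 := norm_sub_le (z + (∑ i ∈ Finset.range k, (g a b (i + 1) : ℂ) * z⁻¹ ^ (i + 1) +
    (mean a : ℂ)) - Real.pi * l * Complex.I)
    (∑ i ∈ Finset.range k, (g a b (i + 1) : ℂ) * z⁻¹ ^ (i + 1))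
  rw [show z + (∑ i ∈ Finset.range k, (g a b (i + 1) : ℂ) * z⁻¹ ^ (i + 1) +
    (mean a : ℂ)) - Real.pi * l * Complex.I -
    ∑ i ∈ Finset.range k, (g a b (i + 1) : ℂ) * z⁻¹ ^ (i + 1) =
    z + mean a - Real.pi * l * Complex.I by ring] at h3
  have h4 : C / ‖z‖ + G / ‖z‖ ≤ 1 := by
    rw [← add_div, div_le_one hzpos]; linarith
  linarith

/-! ### Numbering of a symmetric multiset of complex numbers -/

/-- An infinite set on which a real function has finite sublevel sets can be enumerated so that
the function is monotone. -/
theorem exists_monotone_enumeration {α : Type*} {S : Set α} (f : α → ℝ) (hS : S.Infinite)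
    (hf : ∀ M, {p | p ∈ S ∧ f p ≤ M}.Finite) :
    ∃ e : ℕ → α, BijOn e univ S ∧ Monotone fun n => f (e n) := by
  have hcount : S.Countable := by
    have : S = ⋃ n : ℕ, {p | p ∈ S ∧ f p ≤ n} := by
      ext p
      simp only [mem_iUnion, mem_ofPred_eq, exists_and_left]
      exact ⟨fun h => ⟨h, exists_nat_ge _⟩, fun h => h.1⟩
    rw [this]
    exact countable_iUnion fun n => (hf n).countable
  obtain ⟨ι, hι⟩ : ∃ ι : S → ℕ, Function.Injective ι := hcount.to_subtype.exists_injective_nat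
  have hinf : Infinite S := hS.to_subtype
  -- Ties of `f` are broken by an injection into `ℕ`. Finite sublevel sets make this order locally
  -- finite, with a least and no greatest element, hence isomorphic to `ℕ`.
  let _ : LinearOrder S := LinearOrder.lift' (fun p : S => toLex (f p, ι p)) fun p q h =>
    hι (congrArg (fun x => (ofLex x).2) h)
  have hle : ∀ {p q : S}, p ≤ q → f p ≤ f q := fun {p q} h => by
    rcases (Prod.Lex.le_iff (x := toLex (f p, ι p)) (y := toLex (f q, ι q))).1 h with h | h
    · exact h.le
    · exact h.1.le
  have hfin : ∀ M, {p : S | f p ≤ M}.Finite := fun M =>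
    Set.Finite.of_finite_image (f := Subtype.val) ((hf M).subset (by
      rintro _ ⟨p, hp, rfl⟩; exact ⟨p.2, hp⟩)) Subtype.val_injective.injOn
  let _ : LocallyFiniteOrder S := LocallyFiniteOrder.ofFiniteIcc fun p q =>
    (hfin (f q)).subset fun x hx => hle hx.2
  let _ : SuccOrder S := LinearLocallyFiniteOrder.succOrder S
  let _ : PredOrder S := LinearLocallyFiniteOrder.predOrder S
  have _ : NoMaxOrder S := ⟨fun p => by
    by_contra! h
    exact Set.infinite_univ ((hfin (f p)).subset fun q _ => hle (h q))⟩
  obtain ⟨p₀⟩ : Nonempty S := inferInstance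
  obtain ⟨q, -, hq⟩ := Set.exists_min_image {p : S | f p ≤ f p₀} id (hfin _) ⟨p₀, le_refl (f p₀)⟩
  let _ : OrderBot S :=
    { bot := q
      bot_le := fun x => by
        rcases le_or_gt (f x) (f p₀) with h | h
        · exact hq x h
        · refine (hq p₀ (le_refl (f p₀))).trans (le_of_lt ?_)
          by_contra! h'
          exact absurd (hle h') h.not_ge }
  let Φ : S ≃o ℕ := orderIsoNatOfLinearSuccPredArch
  refine ⟨fun n => Φ.symm n, ⟨fun n _ => (Φ.symm n).2, fun m _ n _ h => ?_, fun p hp => ?_⟩, ?_⟩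
  · exact Φ.symm.injective (Subtype.ext h)
  · exact ⟨Φ ⟨p, hp⟩, mem_univ _, by simp⟩
  · exact fun m n h => hle (Φ.symm.monotone h)

/-- Points repeated according to multiplicity. -/
def withMult (ord : ℂ → ℕ) : Set (ℂ × ℕ) := {p | p.2 < ord p.1}

theorem encard_withMult_fiber (ord : ℂ → ℕ) (z : ℂ) :
    {p | p ∈ withMult ord ∧ p.1 = z}.encard = ord z := by
  have : {p | p ∈ withMult ord ∧ p.1 = z} = (fun i => (z, i)) '' (Finset.range (ord z) : Set ℕ) := by
    ext ⟨w, i⟩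
    simp only [withMult, mem_ofPred_eq, mem_image, Finset.coe_range, mem_Iio, Prod.mk.injEq]
    constructor
    · rintro ⟨h, rfl⟩; exact ⟨i, h, rfl, rfl⟩
    · rintro ⟨i, h, rfl, rfl⟩; exact ⟨h, rfl⟩
  rw [this, Function.Injective.encard_image (fun i j h => by simpa using h),
    Set.encard_coe_eq_coe_finsetCard, Finset.card_range]

theorem finite_and_ncard_withMult {ord : ℂ → ℕ} {P : ℂ → Prop} {Z : Finset ℂ}
    (hZ : ∀ z, z ∈ Z ↔ ord z ≠ 0 ∧ P z) :
    {p | p ∈ withMult ord ∧ P p.1}.Finite ∧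
      {p | p ∈ withMult ord ∧ P p.1}.ncard = ∑ z ∈ Z, ord z := by
  have : {p | p ∈ withMult ord ∧ P p.1} =
      ((Z.sigma fun z => Finset.range (ord z)).map
        (Equiv.sigmaEquivProd ℂ ℕ).toEmbedding : Finset (ℂ × ℕ)) := by
    ext ⟨w, i⟩
    simp only [withMult, mem_ofPred_eq, Finset.coe_map, mem_image, SetLike.mem_coe,
      Finset.mem_sigma, Finset.mem_range, hZ, Sigma.exists]
    constructor
    · rintro ⟨h, hP⟩; exact ⟨w, i, ⟨⟨by omega, hP⟩, h⟩, rfl⟩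
    · rintro ⟨w', i', ⟨⟨-, hP⟩, h⟩, he⟩
      obtain ⟨rfl, rfl⟩ : w' = w ∧ i' = i := by simpa [Equiv.sigmaEquivProd] using he
      exact ⟨h, hP⟩
  rw [this]
  refine ⟨Finset.finite_toSet _, ?_⟩
  rw [Set.ncard_coe_finset, Finset.card_map, Finset.card_sigma]
  simp

/-- A symmetric multiset of complex numbers with `2n` members in the `n`-th horizontal strip can
be numbered by `ℤ \ {0}` by nondecreasing imaginary part, conjugation being `n ↦ -n` off the
real axis. -/
theorem exists_numbering {ord : ℂ → ℕ} (hconj : ∀ z, ord ((starRingEnd ℂ) z) = ord z)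
    {β : ℕ → ℝ} (hβ : Tendsto β atTop atTop) {n₀ : ℕ}
    (hcount : ∀ n ≥ n₀, ∃ Z : Finset ℂ, (∀ z, z ∈ Z ↔ ord z ≠ 0 ∧ |z.im| < β n) ∧
      ∑ z ∈ Z, ord z = 2 * n) :
    ∃ ev : ℤ → ℂ, (∀ n, n ≠ 0 → ord (ev n) ≠ 0) ∧
      (∀ z, {n : ℤ | n ≠ 0 ∧ ev n = z}.encard = ord z) ∧
      (∀ k n : ℤ, k ≠ 0 → n ≠ 0 → k ≤ n → (ev k).im ≤ (ev n).im) ∧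
      ∀ n : ℤ, n ≠ 0 → (ev n).im ≠ 0 → ev (-n) = (starRingEnd ℂ) (ev n) := by
  set κ : ℂ × ℕ → ℂ × ℕ := fun p => ((starRingEnd ℂ) p.1, p.2) with hκ
  have hκκ : ∀ p, κ (κ p) = p := fun p => by simp [hκ]
  have hκE : ∀ p, κ p ∈ withMult ord ↔ p ∈ withMult ord := fun p => by
    simp only [hκ, withMult, mem_ofPred_eq, hconj]
  have hκim : ∀ p, (κ p).1.im = -p.1.im := fun p => by simp [hκ]
  set E₀ : Set (ℂ × ℕ) := {p | p ∈ withMult ord ∧ p.1.im = 0} with hE₀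
  set E₁ : Set (ℂ × ℕ) := {p | p ∈ withMult ord ∧ 0 < p.1.im} with hE₁
  set E₂ : Set (ℂ × ℕ) := {p | p ∈ withMult ord ∧ p.1.im < 0} with hE₂
  have hκinj : Function.Injective κ := fun p q h => by rw [← hκκ p, h, hκκ]
  have hκE₁ : BijOn κ E₁ E₂ := by
    refine ⟨fun p hp => ⟨(hκE p).2 hp.1, ?_⟩, hκinj.injOn, fun p hp =>
      ⟨κ p, ⟨(hκE p).2 hp.1, ?_⟩, hκκ p⟩⟩
    · rw [hκim]; linarith [hp.2]
    · rw [hκim]; linarith [hp.2]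
  have hstrip : ∀ n ≥ n₀, {p | p ∈ withMult ord ∧ |p.1.im| < β n}.Finite ∧
      {p | p ∈ withMult ord ∧ |p.1.im| < β n}.ncard = 2 * n := by
    intro n hn
    obtain ⟨Z, hZ, hsum⟩ := hcount n hn
    rw [← hsum]
    exact finite_and_ncard_withMult hZ
  -- splitting a strip into its three parts
  have hsplit : ∀ n ≥ n₀, 0 < β n → E₀.Finite ∧
      2 * n = E₀.ncard + 2 * {p | p ∈ E₁ ∧ p.1.im < β n}.ncard := by
    intro n hn hpos
    obtain ⟨hfin, hcard⟩ := hstrip n hn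
    have hE₀fin : E₀.Finite := hfin.subset fun p hp => ⟨hp.1, by rw [hp.2, abs_zero]; exact hpos⟩
    have h1fin : {p | p ∈ E₁ ∧ p.1.im < β n}.Finite := hfin.subset fun p hp =>
      ⟨hp.1.1, by rw [abs_of_pos hp.1.2]; exact hp.2⟩
    refine ⟨hE₀fin, ?_⟩
    have hunion : {p | p ∈ withMult ord ∧ |p.1.im| < β n} =
        E₀ ∪ ({p | p ∈ E₁ ∧ p.1.im < β n} ∪ κ '' {p | p ∈ E₁ ∧ p.1.im < β n}) := by
      ext p
      simp only [mem_union, mem_ofPred_eq, hE₀, hE₁, mem_image]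
      constructor
      · rintro ⟨h, hp⟩
        rcases lt_trichotomy p.1.im 0 with h1 | h1 | h1
        · refine Or.inr (Or.inr ⟨κ p, ⟨⟨(hκE p).2 h, ?_⟩, ?_⟩, hκκ p⟩)
          · rw [hκim]; linarith
          · rw [hκim]; rwa [abs_of_neg h1] at hp
        · exact Or.inl ⟨h, h1⟩
        · exact Or.inr (Or.inl ⟨⟨h, h1⟩, by rwa [abs_of_pos h1] at hp⟩)
      · rintro (⟨h, h1⟩ | ⟨⟨h, h1⟩, h2⟩ | ⟨q, ⟨⟨h, h1⟩, h2⟩, rfl⟩)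
        · exact ⟨h, by rw [h1, abs_zero]; exact hpos⟩
        · exact ⟨h, by rwa [abs_of_pos h1]⟩
        · refine ⟨(hκE q).2 h, ?_⟩
          rwa [hκim, abs_neg, abs_of_pos h1]
    have hd1 : Disjoint {p | p ∈ E₁ ∧ p.1.im < β n} (κ '' {p | p ∈ E₁ ∧ p.1.im < β n}) := by
      rw [Set.disjoint_left]
      rintro p ⟨⟨-, h1⟩, -⟩ ⟨q, ⟨⟨-, h2⟩, -⟩, rfl⟩
      rw [hκim] at h1
      linarith
    have hd2 : Disjoint E₀ ({p | p ∈ E₁ ∧ p.1.im < β n} ∪ κ '' {p | p ∈ E₁ ∧ p.1.im < β n}) := by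
      rw [Set.disjoint_left]
      rintro p ⟨-, h0⟩ (⟨⟨-, h1⟩, -⟩ | ⟨q, ⟨⟨-, h2⟩, -⟩, rfl⟩)
      · linarith
      · rw [hκim] at h0
        linarith
    rw [← hcard, hunion, Set.ncard_union_eq hd2 hE₀fin (h1fin.union (h1fin.image _)),
      Set.ncard_union_eq hd1 h1fin (h1fin.image _), Set.ncard_image_of_injective _ hκinj]
    ring
  have hlarge : ∀ M, ∃ n ≥ n₀, M < β n := fun M =>
    ((eventually_ge_atTop n₀).and (hβ.eventually_gt_atTop M)).exists
  obtain ⟨N, hN, hβN⟩ := hlarge 0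
  obtain ⟨hE₀fin, hE₀card⟩ := hsplit N hN hβN
  -- A strip has even count and nonreal points pair off under conjugation, so the real points are
  -- even in number and fit exactly the indices `0 < |n| ≤ r`.
  obtain ⟨r, hr⟩ : ∃ r : ℕ, E₀.ncard = 2 * r :=
    ⟨N - {p | p ∈ E₁ ∧ p.1.im < β N}.ncard, by omega⟩
  have hE₁inf : E₁.Infinite := by
    intro hfin
    obtain ⟨n, ⟨hn, hpos⟩, hn2⟩ := (((eventually_ge_atTop n₀).and
      (hβ.eventually_gt_atTop 0)).and (eventually_gt_atTop (r + E₁.ncard))).exists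
    have h1 := (hsplit n hn hpos).2
    have h2 : {p | p ∈ E₁ ∧ p.1.im < β n}.ncard ≤ E₁.ncard :=
      Set.ncard_le_ncard (fun p hp => hp.1) hfin
    omega
  obtain ⟨e, he, hemono⟩ := exists_monotone_enumeration (fun p : ℂ × ℕ => p.1.im) hE₁inf (by
    intro M
    obtain ⟨n, hn, hM⟩ := hlarge M
    exact (hstrip n hn).1.subset fun p hp => ⟨hp.1.1, by
      rw [abs_of_pos hp.1.2]; exact hp.2.trans_lt hM⟩)
  set S₀ : Set ℤ := {n | n ≠ 0 ∧ |n| ≤ r} with hS₀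
  have hS₀eq : S₀ = (((Finset.Icc (-r : ℤ) r).erase 0 : Finset ℤ) : Set ℤ) := by
    ext n; simp [hS₀, abs_le, and_comm]
  have hcard₀ : S₀.encard = E₀.encard := by
    rw [← hE₀fin.cast_ncard_eq, hr, hS₀eq, Set.encard_coe_eq_coe_finsetCard,
      Finset.card_erase_of_mem (by simp), Int.card_Icc]
    congr 1
    omega
  obtain ⟨ρ, hρ⟩ := (hS₀eq ▸ Finset.finite_toSet _ : S₀.Finite).exists_bijOn_of_encard_eq hcard₀
  -- Real points take the middle indices in any order; the upper half-plane is enumerated from `r +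
  -- 1` on, and the lower one is its mirror image.
  set Ψ : ℤ → ℂ × ℕ := fun n => if |n| ≤ r then ρ n else
    if 0 < n then e (n - r - 1).toNat else κ (e (-n - r - 1).toNat) with hΨ
  have hΨ₀ : ∀ n : ℤ, |n| ≤ (r : ℤ) → Ψ n = ρ n := fun n h => by simp only [hΨ, if_pos h]
  have hΨ₁ : ∀ n : ℤ, (r : ℤ) < n → Ψ n = e (n - r - 1).toNat := fun n h => by
    have h1 : ¬ |n| ≤ (r : ℤ) := by rw [abs_le]; omega
    simp only [hΨ, if_neg h1, if_pos (show 0 < n by omega)]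
  have hΨ₂ : ∀ n : ℤ, n < -(r : ℤ) → Ψ n = κ (e (-n - r - 1).toNat) := fun n h => by
    have h1 : ¬ |n| ≤ (r : ℤ) := by rw [abs_le]; omega
    simp only [hΨ, if_neg h1, if_neg (show ¬ 0 < n by omega)]
  have hB₀ : BijOn Ψ S₀ E₀ := hρ.congr fun n hn => (hΨ₀ n hn.2).symm
  have hB₁ : BijOn Ψ {n : ℤ | (r : ℤ) < n} E₁ := by
    have h1 : BijOn (fun n : ℤ => (n - r - 1).toNat) {n : ℤ | (r : ℤ) < n} univ := by
      refine ⟨fun _ _ => mem_univ _, fun k hk l hl h => ?_, fun i _ => ⟨r + 1 + i, ?_, ?_⟩⟩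
      · simp only [mem_ofPred_eq] at hk hl h; omega
      · simp only [mem_ofPred_eq]; omega
      · simp only; omega
    exact (he.comp h1).congr fun n hn => (hΨ₁ n hn).symm
  have hB₂ : BijOn Ψ {n : ℤ | n < -(r : ℤ)} E₂ := by
    have h1 : BijOn (fun n : ℤ => (-n - r - 1).toNat) {n : ℤ | n < -(r : ℤ)} univ := by
      refine ⟨fun _ _ => mem_univ _, fun k hk l hl h => ?_, fun i _ => ⟨-(r + 1 + i), ?_, ?_⟩⟩
      · simp only [mem_ofPred_eq] at hk hl h; omega
      · simp only [mem_ofPred_eq]; omega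
      · simp only; omega
    exact (hκE₁.comp (he.comp h1)).congr fun n hn => (hΨ₂ n hn).symm
  have hcases : ∀ n : ℤ, n ≠ 0 → n ∈ S₀ ∨ (r : ℤ) < n ∨ n < -(r : ℤ) := by
    intro n hn
    simp only [hS₀, mem_ofPred_eq, abs_le]
    omega
  have hmaps : ∀ n : ℤ, n ≠ 0 → Ψ n ∈ withMult ord := by
    intro n hn
    rcases hcases n hn with h | h | h
    · exact (hB₀.mapsTo h).1
    · exact (hB₁.mapsTo h).1
    · exact (hB₂.mapsTo h).1
  have hinj : InjOn Ψ {n : ℤ | n ≠ 0} := by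
    intro k hk l hl h
    rcases hcases k hk with h1 | h1 | h1 <;> rcases hcases l hl with h2 | h2 | h2
    · exact hB₀.injOn h1 h2 h
    · have h3 := (hB₀.mapsTo h1).2; have h4 := (hB₁.mapsTo h2).2; rw [h] at h3; linarith
    · have h3 := (hB₀.mapsTo h1).2; have h4 := (hB₂.mapsTo h2).2; rw [h] at h3; linarith
    · have h3 := (hB₁.mapsTo h1).2; have h4 := (hB₀.mapsTo h2).2; rw [h] at h3; linarith
    · exact hB₁.injOn h1 h2 h
    · have h3 := (hB₁.mapsTo h1).2; have h4 := (hB₂.mapsTo h2).2; rw [h] at h3; linarith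
    · have h3 := (hB₂.mapsTo h1).2; have h4 := (hB₀.mapsTo h2).2; rw [h] at h3; linarith
    · have h3 := (hB₂.mapsTo h1).2; have h4 := (hB₁.mapsTo h2).2; rw [h] at h3; linarith
    · exact hB₂.injOn h1 h2 h
  have hsurj : ∀ p ∈ withMult ord, ∃ n : ℤ, n ≠ 0 ∧ Ψ n = p := by
    intro p hp
    rcases lt_trichotomy p.1.im 0 with h | h | h
    · obtain ⟨n, hn, hnp⟩ := hB₂.surjOn (show p ∈ E₂ from ⟨hp, h⟩)
      refine ⟨n, ?_, hnp⟩
      simp only [mem_ofPred_eq] at hn; omega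
    · obtain ⟨n, hn, hnp⟩ := hB₀.surjOn (show p ∈ E₀ from ⟨hp, h⟩)
      exact ⟨n, hn.1, hnp⟩
    · obtain ⟨n, hn, hnp⟩ := hB₁.surjOn (show p ∈ E₁ from ⟨hp, h⟩)
      refine ⟨n, ?_, hnp⟩
      simp only [mem_ofPred_eq] at hn; omega
  refine ⟨fun n => (Ψ n).1, fun n hn => ?_, fun z => ?_, ?_, ?_⟩
  · have := hmaps n hn
    simp only [withMult, mem_ofPred_eq] at this
    exact (Nat.zero_le _).trans_lt this |>.ne'
  · rw [← encard_withMult_fiber ord z, ← (hinj.mono fun n hn => hn.1).encard_image]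
    congr 1
    ext p
    constructor
    · rintro ⟨n, ⟨hn, rfl⟩, rfl⟩
      exact ⟨hmaps n hn, rfl⟩
    · rintro ⟨hp, rfl⟩
      obtain ⟨n, hn, rfl⟩ := hsurj p hp
      exact ⟨n, ⟨hn, rfl⟩, rfl⟩
  · intro k n hk hn hkn
    rcases hcases k hk with h1 | h1 | h1 <;> rcases hcases n hn with h2 | h2 | h2
    · exact ((hB₀.mapsTo h1).2.trans (hB₀.mapsTo h2).2.symm).le
    · exact (hB₀.mapsTo h1).2.le.trans (hB₁.mapsTo h2).2.le
    · exfalso; have := abs_le.1 h1.2; omega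
    · exfalso; have := abs_le.1 h2.2; omega
    · simp only [hΨ₁ k h1, hΨ₁ n h2]
      exact hemono (by omega)
    · omega
    · exact (hB₂.mapsTo h1).2.le.trans (hB₀.mapsTo h2).2.symm.le
    · exact ((hB₂.mapsTo h1).2.trans (hB₁.mapsTo h2).2).le
    · simp only [hΨ₂ k h1, hΨ₂ n h2, hκim]
      exact neg_le_neg (hemono (by omega))
  · intro n hn him
    rcases hcases n hn with h1 | h1 | h1
    · exact absurd (hB₀.mapsTo h1).2 him
    · simp only [hΨ₁ n h1, hΨ₂ (-n) (by omega), neg_neg, hκ]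
    · simp only [hΨ₂ n h1, hΨ₁ (-n) (by omega), hκ, Complex.conj_conj]

/-- In any such numbering the `n`-th strip contains exactly the members with index of modulus at
most `n`. -/
theorem abs_im_lt_iff_of_numbering {ord : ℂ → ℕ} {ev : ℤ → ℂ}
    (hord : ∀ n, n ≠ 0 → ord (ev n) ≠ 0)
    (hmult : ∀ z, ord z ≠ 0 → {n : ℤ | n ≠ 0 ∧ ev n = z}.encard = ord z)
    (hmono : ∀ k n : ℤ, k ≠ 0 → n ≠ 0 → k ≤ n → (ev k).im ≤ (ev n).im)
    (hconj : ∀ n : ℤ, n ≠ 0 → (ev n).im ≠ 0 → ev (-n) = (starRingEnd ℂ) (ev n))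
    {B : ℝ} {n : ℕ} {Z : Finset ℂ} (hZ : ∀ z, z ∈ Z ↔ ord z ≠ 0 ∧ |z.im| < B)
    (hsum : ∑ z ∈ Z, ord z = 2 * n) {j : ℤ} (hj : j ≠ 0) : |(ev j).im| < B ↔ |j| ≤ n := by
  set J : Set ℤ := {j | j ≠ 0 ∧ |(ev j).im| < B} with hJ
  have hJeq : J = ⋃ z ∈ (Z : Set ℂ), {n : ℤ | n ≠ 0 ∧ ev n = z} := by
    ext i
    simp only [hJ, mem_ofPred_eq, mem_iUnion, SetLike.mem_coe, exists_prop, hZ]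
    constructor
    · rintro ⟨h1, h2⟩; exact ⟨ev i, ⟨hord i h1, h2⟩, h1, rfl⟩
    · rintro ⟨z, ⟨-, h2⟩, h3, rfl⟩; exact ⟨h3, h2⟩
  have hJcard : J.encard = (2 * n : ℕ) := by
    rw [hJeq, Z.finite_toSet.encard_biUnion, finsum_mem_coe_finset, ← hsum, Nat.cast_sum]
    · exact Finset.sum_congr rfl fun z hz => hmult z ((hZ z).1 hz).1
    · intro z _ w _ hzw
      rw [Function.onFun, Set.disjoint_left]
      rintro i ⟨-, rfl⟩ ⟨-, h⟩
      exact hzw h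
  have hJfin : J.Finite := Set.finite_of_encard_eq_coe hJcard
  -- If `ev i` is real, then so is `ev (-i)`: otherwise the conjugation rule at `-i` would make `ev
  -- i` nonreal.
  have him : ∀ i : ℤ, i ≠ 0 → |(ev (-i)).im| = |(ev i).im| := by
    intro i hi
    by_cases h : (ev i).im = 0
    · by_cases h' : (ev (-i)).im = 0
      · rw [h, h']
      · have := hconj (-i) (by omega) h'
        rw [neg_neg] at this
        rw [this, Complex.conj_im, neg_eq_zero] at h
        exact absurd h h'
    · rw [hconj i hi h, Complex.conj_im, abs_neg]
  have hdown : ∀ i ∈ J, ∀ k : ℤ, k ≠ 0 → |k| ≤ |i| → k ∈ J := by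
    intro i hi k hk hki
    have h1 : |(ev |i|).im| < B := by
      rcases abs_choice i with h | h <;> rw [h]
      · exact hi.2
      · rw [him i hi.1]; exact hi.2
    have h0 : |i| ≠ 0 := abs_ne_zero.2 hi.1
    have h2 : |(ev (-|i|)).im| < B := by rw [him _ h0]; exact h1
    have h3 := abs_le.1 hki
    have h4 := hmono k |i| hk h0 h3.2
    have h5 := hmono (-|i|) k (by omega) hk h3.1
    exact ⟨hk, abs_lt.2 ⟨(abs_lt.1 h2).1.trans_le h5, h4.trans_lt (abs_lt.1 h1).2⟩⟩
  have hcardI : ∀ k : ℕ, ((Finset.Icc (-k : ℤ) k).erase 0).card = 2 * k := by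
    intro k
    rw [Finset.card_erase_of_mem (by simp), Int.card_Icc]; omega
  -- `J` is closed under passing to smaller `|k|`; an element with `|i| > n` would bring in `2 (n +
  -- 1)` indices, against the count `2n`.
  have hsub : J ⊆ ((Finset.Icc (-n : ℤ) n).erase 0 : Finset ℤ) := by
    intro i hi
    rw [SetLike.mem_coe, Finset.mem_erase, Finset.mem_Icc, ← abs_le]
    refine ⟨hi.1, ?_⟩
    by_contra! hlt
    have h1 : (((Finset.Icc (-(n + 1 : ℕ) : ℤ) (n + 1 : ℕ)).erase 0 : Finset ℤ) : Set ℤ) ⊆ J := by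
      intro k hk
      rw [SetLike.mem_coe, Finset.mem_erase, Finset.mem_Icc, ← abs_le] at hk
      refine hdown i hi k hk.1 ?_
      push_cast at hk
      omega
    have h2 := Set.encard_le_encard h1
    rw [hJcard, Set.encard_coe_eq_coe_finsetCard, hcardI] at h2
    have h3 : 2 * (n + 1) ≤ 2 * n := by exact_mod_cast h2
    omega
  have hJeq2 : J = ((Finset.Icc (-n : ℤ) n).erase 0 : Finset ℤ) := by
    refine hJfin.eq_of_subset_of_encard_le hsub ?_
    rw [hJcard, Set.encard_coe_eq_coe_finsetCard, hcardI]
  have h1 : j ∈ J ↔ |(ev j).im| < B := ⟨fun h => h.2, fun h => ⟨hj, h⟩⟩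
  rw [← h1, hJeq2, SetLike.mem_coe, Finset.mem_erase, Finset.mem_Icc, ← abs_le]
  exact ⟨fun h => h.2, fun h => ⟨hj, h⟩⟩

/-! ### Multiplicities, strip counts and the identification of the index. -/

theorem analyticOrderNatAt_conj {F : ℂ → ℂ} (hF : Differentiable ℂ F) {p : ℂ} (hp : F p ≠ 0)
    (h : ∀ z, F ((starRingEnd ℂ) z) = (starRingEnd ℂ) (F z)) (w : ℂ) :
    analyticOrderNatAt F ((starRingEnd ℂ) w) = analyticOrderNatAt F w := by
  obtain ⟨g, hg, hgw, hFg⟩ := exists_eq_pow_order_mul hF hp w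
  set n := analyticOrderNatAt F w
  have hg' : Differentiable ℂ fun z => (starRingEnd ℂ) (g ((starRingEnd ℂ) z)) := fun z => by
    have := (hg ((starRingEnd ℂ) z)).conj_conj
    rwa [Complex.conj_conj] at this
  have h1 : analyticOrderAt F ((starRingEnd ℂ) w) = n := by
    refine (hF.analyticAt _).analyticOrderAt_eq_natCast.2
      ⟨fun z => (starRingEnd ℂ) (g ((starRingEnd ℂ) z)), hg'.analyticAt _, ?_, ?_⟩
    · simpa using hgw
    · refine Eventually.of_forall fun z => ?_
      have h2 := h ((starRingEnd ℂ) z)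
      rw [Complex.conj_conj, hFg ((starRingEnd ℂ) z), map_mul, map_pow, map_sub,
        Complex.conj_conj] at h2
      exact h2
  simp [analyticOrderNatAt, h1]

theorem algMult_eq {a b : ℝ → ℝ} (ha : ContDiffOn ℝ ((1 + 1 : ℕ) : ℕ∞) a (Icc (0 : ℝ) 1))
    (hb : ContDiffOn ℝ ((1 : ℕ) : ℕ∞) b (Icc (0 : ℝ) 1)) (z : ℂ) :
    algMult a b z = analyticOrderNatAt (charFun a b) z := by
  have hF := differentiable_charFun ha.continuousOn hb.continuousOn
  obtain ⟨p, hp⟩ := (exists_sum_order_charFun_eq ha hb).1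
  exact (Nat.cast_analyticOrderNatAt (analyticOrderAt_ne_top_of_entire hF hp z)).symm

theorem isEigenvalue_iff_order_ne_zero {a b : ℝ → ℝ} (ha : ContDiffOn ℝ ((1 + 1 : ℕ) : ℕ∞) a (Icc (0 : ℝ) 1))
    (hb : ContDiffOn ℝ ((1 : ℕ) : ℕ∞) b (Icc (0 : ℝ) 1)) (z : ℂ) :
    IsEigenvalue a b z ↔ analyticOrderNatAt (charFun a b) z ≠ 0 := by
  have hF := differentiable_charFun ha.continuousOn hb.continuousOn
  rw [isEigenvalue_iff ha.continuousOn hb.continuousOn]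
  refine ⟨fun h h0 => ?_, apply_eq_zero_of_analyticOrderNatAt_ne_zero⟩
  have h1 := algMult_eq ha hb z
  rw [h0, algMult, Nat.cast_zero, (hF.analyticAt z).analyticOrderAt_eq_zero] at h1
  exact h1 h

/-- Far away, the discs and the horizontal strips contain the same eigenvalues. -/
theorem exists_sum_order_strip {a b : ℝ → ℝ} (ha : ContDiffOn ℝ ((1 + 1 : ℕ) : ℕ∞) a (Icc (0 : ℝ) 1))
    (hb : ContDiffOn ℝ ((1 : ℕ) : ℕ∞) b (Icc (0 : ℝ) 1)) :
    ∃ n₀ : ℕ, ∀ n ≥ n₀, ∃ Z : Finset ℂ, (∀ z, z ∈ Z ↔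
      analyticOrderNatAt (charFun a b) z ≠ 0 ∧ |z.im| < Real.pi * (n + 1 / 2)) ∧
      ∑ z ∈ Z, analyticOrderNatAt (charFun a b) z = 2 * n := by
  have hF := differentiable_charFun ha.continuousOn hb.continuousOn
  obtain ⟨⟨p, hp⟩, n₁, hn₁⟩ := exists_sum_order_charFun_eq ha hb
  obtain ⟨C, R₀, hC, hR₀, hloc⟩ := exists_int_phase_close le_rfl ha hb
  obtain ⟨n₂, hn₂⟩ := exists_nat_gt (R₀ + ‖(mean a : ℂ)‖)
  refine ⟨max n₁ n₂, fun n hn => ?_⟩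
  have hfin : {z | z ∈ Metric.ball (-(mean a : ℂ)) (Real.pi * (n + 1 / 2)) ∧
      charFun a b z = 0}.Finite :=
    (finite_zeros_closedBall hF hp _ _).subset
      fun z hz => ⟨Metric.ball_subset_closedBall hz.1, hz.2⟩
  refine ⟨hfin.toFinset, fun z => ?_, hn₁ n ((le_max_left _ _).trans hn) _ fun z => by simp⟩
  rw [← isEigenvalue_iff_order_ne_zero ha hb, isEigenvalue_iff ha.continuousOn hb.continuousOn,
    Set.Finite.mem_toFinset, mem_ofPred_eq, and_comm]
  refine and_congr_right fun hz => ?_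
  rw [mem_ball_iff_norm, sub_neg_eq_add]
  have him : (z + (mean a : ℂ)).im = z.im := by simp
  have hpi := Real.pi_gt_three
  constructor
  · intro h
    rw [← him]
    exact (Complex.abs_im_le_norm _).trans_lt h
  · intro h
    -- Small eigenvalues lie in the disc anyway. A large one has `z + ⟨a⟩` within `1` of some `π k
    -- i`; the strip forces `|k| ≤ n`, and `1 + π n < π (n + 1/2)` puts it in the disc.
    rcases lt_or_ge ‖z‖ R₀ with h1 | h1
    · have h2 : (n₂ : ℝ) ≤ n := by exact_mod_cast (le_max_right _ _).trans hn
      have h3 := norm_add_le z (mean a : ℂ)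
      have h4 : (0 : ℝ) ≤ n := by positivity
      nlinarith
    · obtain ⟨k, -, hk⟩ := hloc z h1 hz
      have h2 : |z.im - Real.pi * k| ≤ 1 := by
        refine le_trans ?_ hk
        have : (z + mean a - Real.pi * k * Complex.I).im = z.im - Real.pi * k := by simp
        rw [← this]
        exact Complex.abs_im_le_norm _
      have h3 : Real.pi * |(k : ℝ)| ≤ |z.im| + 1 := by
        rw [show Real.pi * |(k : ℝ)| = |Real.pi * k| by rw [abs_mul, abs_of_pos Real.pi_pos]]
        have := abs_sub_abs_le_abs_sub (Real.pi * k) z.im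
        rw [abs_sub_comm] at this
        linarith
      have h4 : |(k : ℝ)| < n + 1 := by
        have : Real.pi * |(k : ℝ)| < Real.pi * (n + 1) := by linarith
        exact lt_of_mul_lt_mul_left this Real.pi_pos.le
      have h5 : |(k : ℝ)| ≤ n := by
        have : |k| < (n : ℤ) + 1 := by exact_mod_cast h4
        have : |k| ≤ (n : ℤ) := by omega
        exact_mod_cast this
      have h6 := norm_add_le (z + mean a - Real.pi * k * Complex.I) (Real.pi * k * Complex.I)
      rw [sub_add_cancel, norm_pi_mul_int_mul_I] at h6
      have h7 : Real.pi * |(k : ℝ)| ≤ Real.pi * n := mul_le_mul_of_nonneg_left h5 Real.pi_pos.le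
      linarith

theorem exists_isNumbering {a b : ℝ → ℝ} (ha : ContDiffOn ℝ ((1 + 1 : ℕ) : ℕ∞) a (Icc (0 : ℝ) 1))
    (hb : ContDiffOn ℝ ((1 : ℕ) : ℕ∞) b (Icc (0 : ℝ) 1)) :
    ∃ ev : ℤ → ℂ, IsNumbering a b ev := by
  have hF := differentiable_charFun ha.continuousOn hb.continuousOn
  obtain ⟨⟨p, hp⟩, -⟩ := exists_sum_order_charFun_eq ha hb
  obtain ⟨n₀, hn₀⟩ := exists_sum_order_strip ha hb
  have hβ : Tendsto (fun n : ℕ => Real.pi * ((n : ℝ) + 1 / 2)) atTop atTop :=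
    (tendsto_atTop_add_const_right _ _ tendsto_natCast_atTop_atTop).const_mul_atTop Real.pi_pos
  obtain ⟨ev, h1, h2, h3, h4⟩ := exists_numbering (ord := analyticOrderNatAt (charFun a b))
    (analyticOrderNatAt_conj hF hp (charFun_conj ha.continuousOn hb.continuousOn)) hβ hn₀
  exact ⟨ev, fun n hn => (isEigenvalue_iff_order_ne_zero ha hb _).2 (h1 n hn),
    fun z _ => (h2 z).trans (algMult_eq ha hb z).symm, h3, h4⟩

/-- For large `n > 0`, `ev n` lies in the strip of index `n` but not in that of index `n - 1`,
whence `π (n - 1/2) ≤ |Im| < π (n + 1/2)`. Negative indices follow by conjugation. -/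
theorem IsNumbering.exists_abs_im_sub_le {a b : ℝ → ℝ} (ha : ContDiffOn ℝ ((1 + 1 : ℕ) : ℕ∞) a (Icc (0 : ℝ) 1))
    (hb : ContDiffOn ℝ ((1 : ℕ) : ℕ∞) b (Icc (0 : ℝ) 1))
    {ev : ℤ → ℂ} (hev : IsNumbering a b ev) :
    ∃ n₀ : ℕ, ∀ n : ℤ, (n₀ : ℤ) ≤ |n| → |(ev n).im - Real.pi * n| ≤ Real.pi / 2 := by
  obtain ⟨n₀, hn₀⟩ := exists_sum_order_strip ha hb
  have key : ∀ n ≥ n₀, ∀ j : ℤ, j ≠ 0 → (|(ev j).im| < Real.pi * (n + 1 / 2) ↔ |j| ≤ n) := by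
    intro n hn j hj
    obtain ⟨Z, hZ, hsum⟩ := hn₀ n hn
    exact abs_im_lt_iff_of_numbering (ord := analyticOrderNatAt (charFun a b))
      (fun n hn => (isEigenvalue_iff_order_ne_zero ha hb _).1 (hev.isEigenvalue n hn))
      (fun z hz => (hev.mult z ((isEigenvalue_iff_order_ne_zero ha hb z).2 hz)).trans
        (algMult_eq ha hb z)) hev.im_mono hev.conj hZ hsum hj
  have hpos : ∀ n : ℕ, n₀ + 1 ≤ n → |(ev n).im - Real.pi * n| ≤ Real.pi / 2 ∧ (ev n).im ≠ 0 := by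
    intro n hn
    have hn0 : (n : ℤ) ≠ 0 := by omega
    have h1 := (key n (by omega) n hn0).2 (by simp)
    have h2 := (key (n - 1) (by omega) n hn0).not.2 (by
      rw [abs_of_nonneg (by omega : (0 : ℤ) ≤ n)]; omega)
    rw [Nat.cast_sub (by omega), Nat.cast_one, not_lt] at h2
    have hn1 : (1 : ℝ) ≤ n := by exact_mod_cast (by omega : 1 ≤ n)
    have hpi := Real.pi_pos
    have hne : (ev n).im ≠ 0 := by
      intro h0
      rw [h0, abs_zero] at h2
      nlinarith
    -- Monotonicity between `-n` and `n` reads `-Im ≤ Im`, since the value is not real.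
    have hsign : 0 ≤ (ev n).im := by
      have h3 := hev.im_mono (-n) n (by omega) hn0 (by omega)
      rw [hev.conj n hn0 hne, Complex.conj_im] at h3
      linarith
    rw [abs_of_nonneg hsign] at h1 h2
    refine ⟨?_, hne⟩
    rw [abs_le]
    constructor <;> linarith
  refine ⟨n₀ + 1, fun n hn => ?_⟩
  obtain ⟨k, rfl | rfl⟩ := Int.eq_nat_or_neg n
  · have := (hpos k (by simpa using hn)).1
    simpa using this
  · have h := hpos k (by simpa using hn)
    have hk : (k : ℤ) ≠ 0 := by
      rw [abs_neg, Nat.abs_cast] at hn; omega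
    rw [hev.conj k hk h.2, Complex.conj_im]
    push_cast
    rw [show -(ev k).im - Real.pi * -(k : ℝ) = -((ev k).im - Real.pi * k) by ring, abs_neg]
    exact h.1

/-- `Im (ev n)` is within `1` of `π k` and within `π/2` of `π n`. As `1 + π/2 < π`, the two integers
agree. -/
theorem IsNumbering.exists_phase_close {m : ℕ} (hm : 1 ≤ m) {a b : ℝ → ℝ}
    (ha : ContDiffOn ℝ ((m + 1 : ℕ) : ℕ∞) a (Icc (0 : ℝ) 1))
    (hb : ContDiffOn ℝ (m : ℕ∞) b (Icc (0 : ℝ) 1)) {ev : ℤ → ℂ} (hev : IsNumbering a b ev) :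
    ∃ (C : ℝ) (n₀ : ℕ), 0 ≤ C ∧ ∀ n : ℤ, (n₀ : ℤ) ≤ |n| →
      |(n : ℝ)| ≤ ‖ev n‖ ∧
      ‖ev n + ∑ i ∈ Finset.range m, (g a b i : ℂ) * (ev n)⁻¹ ^ i - Real.pi * n * Complex.I‖ ≤
        C * ‖ev n‖⁻¹ ^ m := by
  have ha1 : ContDiffOn ℝ ((1 + 1 : ℕ) : ℕ∞) a (Icc (0 : ℝ) 1) :=
    ha.of_le (by norm_cast; omega)
  have hb1 : ContDiffOn ℝ ((1 : ℕ) : ℕ∞) b (Icc (0 : ℝ) 1) := hb.of_le (by norm_cast)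
  obtain ⟨n₁, hn₁⟩ := hev.exists_abs_im_sub_le ha1 hb1
  obtain ⟨C, R₀, hC, hR₀, hloc⟩ := exists_int_phase_close hm ha hb
  obtain ⟨n₂, hn₂⟩ := exists_nat_gt (R₀ + 1)
  refine ⟨C, max n₁ n₂, hC, fun n hn => ?_⟩
  have h1 := hn₁ n (le_trans (by exact_mod_cast le_max_left _ _) hn)
  have h2 : (n₂ : ℝ) ≤ |(n : ℝ)| := by
    have : (n₂ : ℤ) ≤ |n| := le_trans (by exact_mod_cast le_max_right _ _) hn
    exact_mod_cast this
  have hpi := Real.pi_gt_three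
  have h3 : |(n : ℝ)| ≤ ‖ev n‖ := by
    have h4 := Complex.abs_im_le_norm (ev n)
    have h5 := abs_sub_abs_le_abs_sub (Real.pi * n) (ev n).im
    rw [abs_sub_comm, abs_mul, abs_of_pos Real.pi_pos] at h5
    nlinarith
  refine ⟨h3, ?_⟩
  have hn0 : n ≠ 0 := by
    rintro rfl
    simp only [Int.cast_zero, abs_zero] at h2
    linarith
  obtain ⟨k, hk1, hk2⟩ := hloc (ev n) (by linarith)
    ((isEigenvalue_iff ha.continuousOn hb.continuousOn _).1 (hev.isEigenvalue n hn0))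
  have hkn : k = n := by
    have h4 : |(ev n).im - Real.pi * k| ≤ 1 := by
      refine le_trans ?_ hk2
      have : (ev n + mean a - Real.pi * k * Complex.I).im = (ev n).im - Real.pi * k := by simp
      rw [← this]
      exact Complex.abs_im_le_norm _
    have h5 := abs_sub_le (Real.pi * k) (ev n).im (Real.pi * n)
    rw [abs_sub_comm (Real.pi * k) (ev n).im, ← mul_sub, abs_mul, abs_of_pos Real.pi_pos] at h5
    have h6 : |(k : ℝ) - n| < 1 := by
      by_contra! h
      nlinarith
    have h7 : |k - n| < 1 := by exact_mod_cast h6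
    have := Int.abs_lt_one_iff.1 h7
    omega
  rwa [hkn] at hk1

/-! ### Asymptotic expansions and reversion -/

section Expansion

variable {ι : Type*} {l : Filter ι} {x f g : ι → ℂ} {A B : PowerSeries ℝ} {K : ℕ}

/-- `f` has the asymptotic expansion `A` in powers of `x`, up to the order `K`. -/
def HasExpansion (l : Filter ι) (x f : ι → ℂ) (A : PowerSeries ℝ) (K : ℕ) : Prop :=
  ∃ P : Polynomial ℝ, (∀ i < K, P.coeff i = PowerSeries.coeff i A) ∧
    (fun n => f n - Polynomial.aeval (x n) P) =O[l] fun n => x n ^ K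

theorem isBigO_aeval_one (hx : Tendsto x l (𝓝 0)) (P : Polynomial ℝ) :
    (fun n => Polynomial.aeval (x n) P) =O[l] fun _ => (1 : ℂ) := by
  have h : Continuous fun w : ℂ => Polynomial.aeval w P := by
    simp only [Polynomial.aeval_def]
    exact Polynomial.continuous_eval₂ _ _
  exact ((h.tendsto 0).comp hx).isBigO_one ℂ

theorem isBigO_aeval_of_coeff_eq_zero (hx : Tendsto x l (𝓝 0)) {P : Polynomial ℝ}
    (hP : ∀ i < K, P.coeff i = 0) :
    (fun n => Polynomial.aeval (x n) P) =O[l] fun n => x n ^ K := by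
  obtain ⟨Q, rfl⟩ := Polynomial.X_pow_dvd_iff.2 hP
  simpa using (isBigO_refl (fun n => x n ^ K) l).mul (isBigO_aeval_one hx Q)

theorem HasExpansion.isBigO_one (hx : Tendsto x l (𝓝 0)) (h : HasExpansion l x f A K) :
    f =O[l] fun _ => (1 : ℂ) := by
  obtain ⟨P, -, hf⟩ := h
  have h1 : (fun n => x n ^ K) =O[l] fun _ => (1 : ℂ) := (hx.pow K).isBigO_one ℂ
  exact ((hf.trans h1).add (isBigO_aeval_one hx P)).congr_left fun n => by ring

theorem hasExpansion_one : HasExpansion l x (fun _ => 1) 1 K :=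
  ⟨1, fun i _ => by rw [Polynomial.coeff_one, PowerSeries.coeff_one],
    by simpa using isBigO_zero _ _⟩

theorem coeff_mul_congr {P Q : Polynomial ℝ} (hP : ∀ i < K, P.coeff i = PowerSeries.coeff i A)
    (hQ : ∀ i < K, Q.coeff i = PowerSeries.coeff i B) :
    ∀ i < K, (P * Q).coeff i = PowerSeries.coeff i (A * B) := by
  intro i hi
  rw [Polynomial.coeff_mul, PowerSeries.coeff_mul]
  refine Finset.sum_congr rfl fun p hp => ?_
  have := Finset.HasAntidiagonal.mem_antidiagonal.1 hp
  rw [hP _ (by omega), hQ _ (by omega)]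

theorem HasExpansion.mul (hx : Tendsto x l (𝓝 0)) (hf : HasExpansion l x f A K)
    (hg : HasExpansion l x g B K) : HasExpansion l x (fun n => f n * g n) (A * B) K := by
  have hf1 := hf.isBigO_one hx
  obtain ⟨P, hP, hf⟩ := hf
  obtain ⟨Q, hQ, hg⟩ := hg
  refine ⟨P * Q, coeff_mul_congr hP hQ, ?_⟩
  have h1 := hf1.mul hg
  have h2 := hf.mul (isBigO_aeval_one hx Q)
  simp only [one_mul, mul_one] at h1 h2
  refine (h1.add h2).congr_left fun n => ?_
  rw [map_mul]; ring

theorem HasExpansion.pow (hx : Tendsto x l (𝓝 0)) (hf : HasExpansion l x f A K) (i : ℕ) :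
    HasExpansion l x (fun n => f n ^ i) (A ^ i) K := by
  induction i with
  | zero => simpa using hasExpansion_one
  | succ i ih => simpa only [pow_succ] using ih.mul hx hf

/-- With `V` the truncation of `A⁻¹`, `1/f - V = (1/f) ((1 - P V) - (f - P) V)`. Here `1/f` is
bounded and `1 - P V` has no coefficient below order `K`. -/
theorem HasExpansion.inv (hx : Tendsto x l (𝓝 0)) (hK : K ≠ 0) (hf : HasExpansion l x f A K)
    (hA : PowerSeries.constantCoeff A ≠ 0) :
    HasExpansion l x (fun n => (f n)⁻¹) A⁻¹ K := by
  obtain ⟨P, hP, hfP⟩ := hf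
  have hlim : Tendsto f l (𝓝 ((PowerSeries.constantCoeff A : ℝ) : ℂ)) := by
    have h1 : Tendsto (fun n => Polynomial.aeval (x n) P) l (𝓝 (Polynomial.aeval (0 : ℂ) P)) := by
      have h : Continuous fun w : ℂ => Polynomial.aeval w P := by
        simp only [Polynomial.aeval_def]
        exact Polynomial.continuous_eval₂ _ _
      exact (h.tendsto 0).comp hx
    have h2 : Tendsto (fun n => f n - Polynomial.aeval (x n) P) l (𝓝 0) := by
      refine hfP.trans_tendsto ?_
      simpa [hK] using hx.pow K
    have h3 := h2.add h1
    rw [zero_add, ← Polynomial.coeff_zero_eq_aeval_zero', hP 0 (by omega)] at h3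
    simpa using h3
  have hA' : ((PowerSeries.constantCoeff A : ℝ) : ℂ) ≠ 0 := by exact_mod_cast hA
  have hne : ∀ᶠ n in l, f n ≠ 0 := hlim.eventually_ne hA'
  have hinv : (fun n => (f n)⁻¹) =O[l] fun _ => (1 : ℂ) := (hlim.inv₀ hA').isBigO_one ℂ
  have hV : ∀ i < K, (PowerSeries.trunc K A⁻¹).coeff i = PowerSeries.coeff i A⁻¹ := fun i hi => by
    rw [PowerSeries.coeff_trunc, if_pos hi]
  refine ⟨PowerSeries.trunc K A⁻¹, hV, ?_⟩
  set V := PowerSeries.trunc K A⁻¹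
  have h1 := coeff_mul_congr hP hV
  rw [PowerSeries.mul_inv_cancel A hA] at h1
  have h2 := isBigO_aeval_of_coeff_eq_zero hx (K := K) (P := 1 - P * V) fun i hi => by
    rw [Polynomial.coeff_sub, h1 i hi, Polynomial.coeff_one, PowerSeries.coeff_one]
    simp only [sub_self]
  have h3 := hfP.mul (isBigO_aeval_one hx V)
  simp only [mul_one] at h3
  have h4 := hinv.mul (h2.sub h3)
  simp only [one_mul] at h4
  refine h4.congr' ?_ EventuallyEq.rfl
  filter_upwards [hne] with n hn
  rw [map_sub, map_mul, map_one]
  field_simp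
  ring

end Expansion

/-- The truncated formal solution `W = 1 + ∑_{l<k} d_l X^{l+1}`. -/
noncomputable def revertSeries (q : ℕ → ℝ) (k : ℕ) : PowerSeries ℝ :=
  1 + ∑ l : Fin k, PowerSeries.C (revert q l) * PowerSeries.X ^ ((l : ℕ) + 1)

theorem constantCoeff_revertSeries (q : ℕ → ℝ) (k : ℕ) :
    PowerSeries.constantCoeff (revertSeries q k) = 1 := by
  simp [revertSeries]

theorem X_pow_dvd_revertSeries_sub (q : ℕ → ℝ) {j k : ℕ} (hjk : j ≤ k) :
    PowerSeries.X ^ (j + 1) ∣ revertSeries q k - revertSeries q j := by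
  induction k, hjk using Nat.le_induction with
  | base => simp
  | succ k hjk ih =>
    have : revertSeries q (k + 1) - revertSeries q j = (revertSeries q k - revertSeries q j) +
        PowerSeries.C (revert q k) * PowerSeries.X ^ (k + 1) := by
      simp only [revertSeries, Fin.sum_univ_castSucc, Fin.val_castSucc, Fin.val_last]
      ring
    rw [this]
    exact dvd_add ih ((pow_dvd_pow _ (by omega)).mul_left _)

/-- The truncations at `j` and `k` agree modulo `X ^ (j + 1)`, and so do the powers of their
inverses. One truncation thus serves all coefficients up to `k` in the recursion. -/
theorem coeff_inv_pow_revertSeries (q : ℕ → ℝ) {i j k : ℕ} (hjk : j ≤ k) :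
    PowerSeries.coeff (j - i) ((revertSeries q k)⁻¹ ^ i) =
      PowerSeries.coeff (j - i) ((revertSeries q j)⁻¹ ^ i) := by
  have hk : PowerSeries.constantCoeff (revertSeries q k) ≠ 0 := by
    rw [constantCoeff_revertSeries]; exact one_ne_zero
  have hj : PowerSeries.constantCoeff (revertSeries q j) ≠ 0 := by
    rw [constantCoeff_revertSeries]; exact one_ne_zero
  have h1 : (revertSeries q k)⁻¹ - (revertSeries q j)⁻¹ =
      -((revertSeries q k)⁻¹ * (revertSeries q j)⁻¹) *
        (revertSeries q k - revertSeries q j) := by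
    have e1 := PowerSeries.mul_inv_cancel _ hk
    have e2 := PowerSeries.mul_inv_cancel _ hj
    linear_combination (revertSeries q j)⁻¹ * e1 - (revertSeries q k)⁻¹ * e2
  have h2 : PowerSeries.X ^ (j + 1) ∣ (revertSeries q k)⁻¹ ^ i - (revertSeries q j)⁻¹ ^ i := by
    refine dvd_trans ?_ (sub_dvd_pow_sub_pow _ _ i)
    rw [h1]
    exact (X_pow_dvd_revertSeries_sub q hjk).mul_left _
  have h3 := PowerSeries.X_pow_dvd_iff.1 h2 (j - i) (by omega)
  rwa [map_sub, sub_eq_zero] at h3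

theorem revert_eq (q : ℕ → ℝ) {j k : ℕ} (hjk : j ≤ k) :
    revert q j = -∑ i ∈ Finset.range (j + 1),
      q i * PowerSeries.coeff (j - i) ((revertSeries q k)⁻¹ ^ i) := by
  rw [revert]
  simp only [coeff_inv_pow_revertSeries q hjk]
  rfl

/-- Solutions of `z + ∑_{i<m} q_i z^{-i} = N + O(N^{-m})` are given asymptotically by the
formal reversion. -/
theorem sub_revert_isBigO {ι : Type*} {l : Filter ι} {z N : ι → ℂ} (q : ℕ → ℝ) {m : ℕ}
    (hN : Tendsto (fun n => (N n)⁻¹) l (𝓝 0)) (hN0 : ∀ᶠ n in l, N n ≠ 0)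
    (hz : (fun n => (z n)⁻¹) =O[l] fun n => (N n)⁻¹)
    (h : (fun n => z n + ∑ i ∈ Finset.range m, (q i : ℂ) * (z n)⁻¹ ^ i - N n) =O[l]
      fun n => (N n)⁻¹ ^ m) :
    (fun n => z n - (N n + ∑ j ∈ Finset.range m, (revert q j : ℂ) * (N n)⁻¹ ^ j)) =O[l]
      fun n => (N n)⁻¹ ^ m := by
  set x : ι → ℂ := fun n => (N n)⁻¹ with hx
  have hx1 : x =O[l] fun _ => (1 : ℂ) := hN.isBigO_one ℂ
  have hxpow : ∀ {i j : ℕ}, i ≤ j → (fun n => x n ^ j) =O[l] fun n => x n ^ i := by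
    intro i j hij
    obtain ⟨d, rfl⟩ := Nat.exists_eq_add_of_le hij
    have h1 := (isBigO_refl (fun n => x n ^ i) l).mul (hx1.pow d)
    simpa [pow_add] using h1
  -- Bootstrap in `k`: an expansion of `z` with error `x ^ k` gives `z x` with error `x ^ (k + 1)`.
  -- Inserting `z^{-i} = x^i (z x)^{-i}` into the equation then returns `z` with one order gained.
  suffices H : ∀ k ≤ m, (fun n => z n - (N n + ∑ j ∈ Finset.range k,
      (revert q j : ℂ) * x n ^ j)) =O[l] fun n => x n ^ k from H m le_rfl
  intro k
  induction k with
  | zero =>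
    intro _
    have h1 : (fun n => ∑ i ∈ Finset.range m, (q i : ℂ) * (z n)⁻¹ ^ i) =O[l]
        fun _ => (1 : ℂ) := by
      refine IsBigO.fun_sum fun i _ => ?_
      have h2 := ((hz.trans hx1).pow i).const_mul_left (q i : ℂ)
      simpa using h2
    have h2 : (fun n => x n ^ m) =O[l] fun _ => (1 : ℂ) := by simpa using hx1.pow m
    refine ((h.trans h2).sub h1).congr (fun n => ?_) fun n => ?_
    · simp; ring
    · simp
  | succ k ih =>
    intro hk
    have ihk := ih (by omega)
    have hρ : HasExpansion l x (fun n => z n * x n) (revertSeries q k) (k + 1) := by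
      refine ⟨1 + ∑ j : Fin k, Polynomial.C (revert q j) * Polynomial.X ^ ((j : ℕ) + 1),
        fun i _ => ?_, ?_⟩
      · simp only [revertSeries, Polynomial.coeff_add, map_add, Polynomial.finsetSum_coeff,
          map_sum, Polynomial.coeff_C_mul_X_pow, PowerSeries.coeff_C_mul_X_pow,
          Polynomial.coeff_one, PowerSeries.coeff_one]
      · refine ((ihk.mul (isBigO_refl x l)).congr' ?_ ?_)
        · filter_upwards [hN0] with n hn
          simp only [map_add, map_one, map_sum, map_mul, map_pow, Polynomial.aeval_C,
            Polynomial.aeval_X, Complex.coe_algebraMap]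
          rw [Fin.sum_univ_eq_sum_range (fun j => (revert q j : ℂ) * x n ^ (j + 1)), sub_mul,
            add_mul, Finset.sum_mul]
          have : N n * x n = 1 := mul_inv_cancel₀ hn
          rw [this]
          simp only [pow_succ, mul_assoc]
        · exact Eventually.of_forall fun n => (pow_succ _ _).symm
    have hinv := hρ.inv hN (by omega) (by rw [constantCoeff_revertSeries]; exact one_ne_zero)
    have hV : ∀ i, ∃ V : Polynomial ℝ,
        (∀ j < k + 1, V.coeff j = PowerSeries.coeff j ((revertSeries q k)⁻¹ ^ i)) ∧
        (fun n => ((z n * x n)⁻¹) ^ i - Polynomial.aeval (x n) V) =O[l] fun n => x n ^ (k + 1) :=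
      fun i => hinv.pow hN i
    choose V hVc hVO using hV
    -- the expansion of `z - N`
    have hexp : (fun n => z n - N n - Polynomial.aeval (x n)
        (-∑ i ∈ Finset.range m, Polynomial.C (q i) * (Polynomial.X ^ i * V i))) =O[l]
        fun n => x n ^ (k + 1) := by
      have h1 : (fun n => ∑ i ∈ Finset.range m, (q i : ℂ) *
          (x n ^ i * (((z n * x n)⁻¹) ^ i - Polynomial.aeval (x n) (V i)))) =O[l]
          fun n => x n ^ (k + 1) := by
        refine IsBigO.fun_sum fun i _ => IsBigO.const_mul_left ?_ _
        have h2 := (hx1.pow i).mul (hVO i)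
        simpa using h2
      refine ((h.trans (hxpow hk)).sub h1).congr' ?_ EventuallyEq.rfl
      filter_upwards [hN0] with n hn
      simp only [map_neg, map_sum, map_mul, map_pow, Polynomial.aeval_C, Polynomial.aeval_X,
        Complex.coe_algebraMap]
      have h3 : ∀ i, x n ^ i * ((z n * x n)⁻¹) ^ i = (z n)⁻¹ ^ i := fun i => by
        rw [← mul_pow, mul_inv, mul_left_comm, mul_inv_cancel₀ (inv_ne_zero hn), mul_one]
      simp only [mul_sub, h3, Finset.sum_sub_distrib]
      ring
    -- Up to order `k` the coefficients found by substitution are those of the defining recursion of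
    -- `revert`; terms with `i > j` drop out through the factor `X ^ i`.
    have hcoeff := isBigO_aeval_of_coeff_eq_zero hN (K := k + 1)
      (P := (-∑ i ∈ Finset.range m, Polynomial.C (q i) * (Polynomial.X ^ i * V i)) -
        ∑ j ∈ Finset.range (k + 1), Polynomial.C (revert q j) * Polynomial.X ^ j) (by
      intro j hj
      rw [Polynomial.coeff_sub, Polynomial.coeff_neg, Polynomial.finsetSum_coeff,
        Polynomial.finsetSum_coeff, sub_eq_zero]
      simp only [Polynomial.coeff_C_mul, Polynomial.coeff_X_pow_mul', Polynomial.coeff_X_pow,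
        mul_ite, mul_one, mul_zero]
      rw [Finset.sum_ite_eq, if_pos (Finset.mem_range.2 hj),
        revert_eq q (Nat.lt_succ_iff.1 hj)]
      congr 1
      rw [← Finset.sum_subset (Finset.range_subset_range.2 (by omega : j + 1 ≤ m))]
      · refine Finset.sum_congr rfl fun i hi => ?_
        have := Finset.mem_range.1 hi
        rw [if_pos (by omega), hVc i (j - i) (by omega)]
      · intro i _ hi
        rw [if_neg]
        simpa using hi)
    refine (hexp.add hcoeff).congr_left fun n => ?_
    simp only [map_sub, map_sum, map_mul, map_pow, Polynomial.aeval_C, Polynomial.aeval_X,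
      Complex.coe_algebraMap]
    ring

/-- Only `|n| → ∞` matters, so both ends of `ℤ` are covered at once by reversion with `N = π n i`.
-/
theorem IsNumbering.isBigO {m : ℕ} (hm : 1 ≤ m) {a b : ℝ → ℝ}
    (ha : ContDiffOn ℝ ((m + 1 : ℕ) : ℕ∞) a (Icc (0 : ℝ) 1))
    (hb : ContDiffOn ℝ (m : ℕ∞) b (Icc (0 : ℝ) 1)) {ev : ℤ → ℂ} (hev : IsNumbering a b ev)
    {l : Filter ℤ} (hl : Tendsto (fun n : ℤ => |n|) l atTop) :
    (fun n : ℤ => ev n - ((Real.pi : ℂ) * (n : ℂ) * Complex.I +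
        ∑ j ∈ Finset.range m, c a b j * (n : ℂ) ^ (-(j : ℤ)))) =O[l]
      (fun n : ℤ => (n : ℝ) ^ (-(m : ℤ))) := by
  obtain ⟨C, n₀, hC, hn₀⟩ := hev.exists_phase_close hm ha hb
  have hlarge : ∀ᶠ n : ℤ in l, (n₀ : ℤ) ≤ |n| ∧ 1 ≤ |n| :=
    (hl.eventually_ge_atTop _).and (hl.eventually_ge_atTop _)
  set N : ℤ → ℂ := fun n => Real.pi * n * Complex.I with hN
  have hNnorm : ∀ n, ‖N n‖ = Real.pi * |(n : ℝ)| := norm_pi_mul_int_mul_I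
  have hNinv : Tendsto (fun n => (N n)⁻¹) l (𝓝 0) := by
    rw [tendsto_zero_iff_norm_tendsto_zero]
    simp only [norm_inv, hNnorm]
    refine Tendsto.inv_tendsto_atTop (Tendsto.const_mul_atTop Real.pi_pos ?_)
    have := tendsto_intCast_atTop_atTop (R := ℝ) |>.comp hl
    refine this.congr fun n => ?_
    simp
  have hbound : ∀ n : ℤ, (n₀ : ℤ) ≤ |n| ∧ 1 ≤ |n| → ‖ev n‖⁻¹ ≤ Real.pi * ‖(N n)⁻¹‖ := by
    intro n hn
    have h1 : (0 : ℝ) < |(n : ℝ)| := by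
      have : (1 : ℝ) ≤ |(n : ℝ)| := by exact_mod_cast hn.2
      linarith
    rw [norm_inv, hNnorm, mul_inv, mul_inv_cancel_left₀ Real.pi_ne_zero]
    exact inv_anti₀ h1 (hn₀ n hn.1).1
  have key := sub_revert_isBigO (l := l) (z := ev) (N := N) (g a b) (m := m) hNinv
    (by
      filter_upwards [hlarge] with n hn
      rw [← norm_pos_iff, hNnorm]
      have : (1 : ℝ) ≤ |(n : ℝ)| := by exact_mod_cast hn.2
      have := Real.pi_pos
      positivity)
    (IsBigO.of_bound Real.pi (by
      filter_upwards [hlarge] with n hn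
      rw [norm_inv]
      exact hbound n hn))
    (IsBigO.of_bound (C * Real.pi ^ m) (by
      filter_upwards [hlarge] with n hn
      refine (hn₀ n hn.1).2.trans ?_
      rw [norm_pow, mul_assoc, ← mul_pow]
      exact mul_le_mul_of_nonneg_left
        (pow_le_pow_left₀ (by positivity) (hbound n hn) m) hC))
  refine (key.congr_left fun n => ?_).trans (IsBigO.of_bound (Real.pi⁻¹ ^ m) ?_)
  · congr 2
    refine Finset.sum_congr rfl fun j _ => ?_
    rw [c, zpow_neg, zpow_natCast, div_eq_mul_inv, mul_assoc, ← mul_inv, ← mul_pow, ← inv_pow]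
    congr 2
    simp only [hN]
    ring
  · refine Eventually.of_forall fun n => ?_
    rw [norm_pow, norm_inv, hNnorm, zpow_neg, zpow_natCast, norm_inv, norm_pow, Real.norm_eq_abs,
      mul_inv, mul_pow, inv_pow |(n : ℝ)|]

/-! ### The first three coefficients in closed form. -/

theorem revert_zero (q : ℕ → ℝ) : revert q 0 = -q 0 := by
  rw [revert_eq q le_rfl]; simp

theorem revert_one (q : ℕ → ℝ) : revert q 1 = -q 1 := by
  rw [revert_eq q le_rfl]
  simp [Finset.sum_range_succ, PowerSeries.coeff_one, constantCoeff_revertSeries]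

theorem revert_two (q : ℕ → ℝ) : revert q 2 = -(q 2 + q 0 * q 1) := by
  have h0 : PowerSeries.constantCoeff (revertSeries q 2) ≠ 0 := by
    rw [constantCoeff_revertSeries]; exact one_ne_zero
  have h1 : PowerSeries.coeff 1 (revertSeries q 2) = -q 0 := by
    rw [← revert_zero]
    simp [revertSeries, Fin.sum_univ_two, PowerSeries.coeff_one]
  have h2 : PowerSeries.coeff 1 (revertSeries q 2)⁻¹ = q 0 := by
    have h := congrArg (PowerSeries.coeff 1) (PowerSeries.mul_inv_cancel _ h0)
    rw [PowerSeries.coeff_mul, Finset.Nat.antidiagonal_succ] at h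
    simp [h1, constantCoeff_revertSeries, PowerSeries.coeff_one] at h
    linarith
  rw [revert_eq q le_rfl]
  simp [Finset.sum_range_succ, PowerSeries.coeff_one, constantCoeff_revertSeries, h2]
  ring

theorem g_one (a b : ℝ → ℝ) : g a b 1 = -mean (fun x => a x ^ 2 + b x) / 2 := by
  have : (fun x => phi 1 a b 1 x + phi (-1) a b 1 x) = fun x => -(a x ^ 2 + b x) := by
    ext x; rw [phi, phi]; ring
  rw [g, this, mean, mean, intervalIntegral.integral_neg]

theorem mean_D {f : ℝ → ℝ} (hf : ContDiffOn ℝ ((0 + 1 : ℕ) : ℕ∞) f (Icc 0 1)) :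
    mean (D f) = f 1 - f 0 := by
  refine intervalIntegral.integral_eq_sub_of_hasDerivAt_of_le zero_le_one hf.continuousOn
    (fun x hx => ?_) ?_
  · exact (hasDerivWithinAt_D hf (Ioo_subset_Icc_self hx)).hasDerivAt (Icc_mem_nhds hx.1 hx.2)
  · refine ContinuousOn.intervalIntegrable ?_
    rw [uIcc_of_le zero_le_one]
    exact (contDiffOn_D hf).continuousOn

/-- In the sum over the two signs only the difference of the two `φ_1`, namely `-a'`, is
differentiated. Hence `b'` drops out and `a''` integrates to the boundary term. -/
theorem g_two {a b : ℝ → ℝ} (ha : ContDiffOn ℝ ((1 + 1 : ℕ) : ℕ∞) a (Icc (0 : ℝ) 1))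
    (hb : ContDiffOn ℝ ((1 : ℕ) : ℕ∞) b (Icc (0 : ℝ) 1)) :
    g a b 2 = (D a 1 - D a 0) / 4 + mean (fun x => a x * (a x ^ 2 + b x)) / 2 := by
  have hDa : ContDiffOn ℝ ((0 + 1 : ℕ) : ℕ∞) (D a) (Icc 0 1) := contDiffOn_D ha
  have hphi : ∀ s, ContDiffOn ℝ ((0 + 1 : ℕ) : ℕ∞) (phi s a b 1) (Icc 0 1) := fun s =>
    contDiffOn_phi ha hb s 1 1 rfl
  have hdiff : ∀ x ∈ Icc (0 : ℝ) 1, D (phi 1 a b 1) x - D (phi (-1) a b 1) x = -D (D a) x := by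
    intro x hx
    have h1 := (hasDerivWithinAt_D (hphi 1) hx).sub (hasDerivWithinAt_D (hphi (-1)) hx)
    have h2 := (hasDerivWithinAt_D hDa hx).neg
    have h3 : phi 1 a b 1 - phi (-1) a b 1 = -D a := by
      ext y
      simp only [Pi.sub_apply, Pi.neg_apply]
      rw [phi, phi]; ring
    rw [h3] at h1
    exact (uniqueDiffOn_Icc zero_lt_one x hx).eq_deriv _ h1 h2
  have hsum : ∀ x ∈ Icc (0 : ℝ) 1, phi 1 a b 2 x + phi (-1) a b 2 x =
      D (D a) x / 2 + a x * (a x ^ 2 + b x) := by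
    intro x hx
    have h1 := hdiff x hx
    have h2 := two_mul_phi_add_two_add 1 a b 0 x
    have h3 := two_mul_phi_add_two_add (-1) a b 0 x
    have h4 := two_mul_phi_one_add 1 a b x
    have h5 := two_mul_phi_one_add (-1) a b x
    have h6 : ∀ s, phi s a b 0 = a := fun s => by rw [phi]
    simp only [zero_add, Finset.sum_range_succ, Finset.sum_range_zero, Nat.sub_zero, Nat.sub_self,
      h6] at h2 h3 h4 h5
    linear_combination h2 / 2 + h3 / 2 - h1 / 2 - a x * (h4 + h5) / 2
  have hint : ∀ {f : ℝ → ℝ}, ContinuousOn f (Icc 0 1) →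
      IntervalIntegrable f MeasureTheory.volume 0 1 := fun hf => by
    refine ContinuousOn.intervalIntegrable ?_
    rwa [uIcc_of_le zero_le_one]
  have hac := ha.continuousOn
  have hbc := hb.continuousOn
  have h1 : mean (fun x => phi 1 a b 2 x + phi (-1) a b 2 x) =
      ∫ x in (0 : ℝ)..1, (D (D a) x / 2 + a x * (a x ^ 2 + b x)) := by
    refine intervalIntegral.integral_congr fun x hx => ?_
    rw [uIcc_of_le zero_le_one] at hx
    exact hsum x hx
  rw [g, h1, intervalIntegral.integral_add
    ((hint (contDiffOn_D hDa).continuousOn).div_const 2) (hint (by fun_prop)),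
    intervalIntegral.integral_div]
  have h2 : ∫ x in (0 : ℝ)..1, D (D a) x = D a 1 - D a 0 := mean_D hDa
  rw [h2, mean]
  ring

end DampedWave

theorem theorem1 (m : ℕ) (hm : 1 ≤ m) (a b : ℝ → ℝ)
    (ha : ContDiffOn ℝ ((m + 1 : ℕ) : ℕ∞) a (Icc (0 : ℝ) 1))
    (hb : ContDiffOn ℝ (m : ℕ∞) b (Icc (0 : ℝ) 1)) :
    (∃ ev : ℤ → ℂ, DampedWave.IsNumbering a b ev) ∧
    (∀ ev : ℤ → ℂ, DampedWave.IsNumbering a b ev →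
      ∀ l : Filter ℤ, (l = atTop ∨ l = atBot) →
        (fun n : ℤ => ev n - ((Real.pi : ℂ) * (n : ℂ) * Complex.I +
            ∑ j ∈ Finset.range m, DampedWave.c a b j * (n : ℂ) ^ (-(j : ℤ))))
          =O[l] (fun n : ℤ => (n : ℝ) ^ (-(m : ℤ)))) ∧
    DampedWave.c a b 0 = -((DampedWave.mean a : ℝ) : ℂ) ∧
    DampedWave.c a b 1 =
      ((DampedWave.mean (fun x => a x ^ 2 + b x) : ℝ) : ℂ) /
        (2 * (Real.pi : ℂ) * Complex.I) ∧
    DampedWave.c a b 2 =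
      (((1 / (2 * Real.pi ^ 2)) *
        (DampedWave.mean (fun x => a x * (a x ^ 2 + b x))
          - DampedWave.mean a * DampedWave.mean (fun x => a x ^ 2 + b x)
          + (DampedWave.D a 1 - DampedWave.D a 0) / 2) : ℝ) : ℂ) := by
  -- Counting, numbering and the closed form of `c_2` need only the regularity of the case `m = 1`.
  have ha1 : ContDiffOn ℝ ((1 + 1 : ℕ) : ℕ∞) a (Icc (0 : ℝ) 1) :=
    ha.of_le (by norm_cast; omega)
  have hb1 : ContDiffOn ℝ ((1 : ℕ) : ℕ∞) b (Icc (0 : ℝ) 1) := hb.of_le (by norm_cast)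
  have hpi : (Real.pi : ℂ) ≠ 0 := by exact_mod_cast Real.pi_ne_zero
  refine ⟨DampedWave.exists_isNumbering ha1 hb1, ?_, ?_, ?_, ?_⟩
  · rintro ev hev l (rfl | rfl)
    · exact hev.isBigO hm ha hb tendsto_abs_atTop_atTop
    · exact hev.isBigO hm ha hb tendsto_abs_atBot_atTop
  · rw [DampedWave.c, DampedWave.revert_zero, DampedWave.g_zero]
    simp
  · rw [DampedWave.c, DampedWave.revert_one, DampedWave.g_one]
    push_cast
    field_simp
  · rw [DampedWave.c, DampedWave.revert_two, DampedWave.g_zero, DampedWave.g_one,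
      DampedWave.g_two ha1 hb1, mul_pow, Complex.I_sq]
    push_cast
    field_simp
    ring
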